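/- **Definitions.** A *centred permutation* of length $n$ is a permutation of $n+1$ points, one of which is designated as the origin (and is not counted in the length). The *box sum* $\pi^\circ\boxplus\sigma^\circ$ is obtained by inflating the origin of $\sigma^\circ$ by a copy of $\pi^\circ$, the origin of this copy being the new origin. A centred permutation is *$\boxplus$-decomposable* if it equals $\pi_1^\circ\boxplus\pi_2^\circ$ for two centred permutations $\pi_1^\circ,\pi_2^\circ$ of smaller length. A *pin word* of length $n\ge 1$ is a numeral from $\{1,2,3,4\}$ followed by $n-1$ letters from $\{u,d,l,r\}$ that alternate between the vertical letters $u,d$ and the horizontal letters $l,r$. It *generates* a centred permutation $\pi_w^\circ$ of length $n$ as follows. Place the origin $p_0$, and place $p_1$ in the quadrant about $p_0$ named by the numeral (quadrants are numbered anticlockwise from the upper right). For $k\ge2$ place $p_k$ above, below, to the left or to the right ($u,d,l,r$) of the bounding rectangle of $p_0,\dots,p_{k-1}$, according to the $k$-th symbol of $w$, so that its other coordinate lies strictly between that of $p_{k-1}$ and those of all of $p_0,\dots,p_{k-2}$. Then read off the centred permutation of $p_0,\dots,p_n$ with origin $p_0$. A *collision* is a set of at least two pin words which all generate the same centred permutation.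 $(f)^k$ denotes $f$ repeated $k$ times. **Theorem (Classification of $\boxplus$-decomposables and collisions).** **(A)** The pin words $w$ for which $\pi_w^\circ$ is $\boxplus$-decomposable are exactly the following. * Length $1$: none. * Length $2$ (8 words): $1l, 1d, 2r, 2d, 3u, 3r, 4l, 4u$. * Length $3$ (8 words): $1ld, 1dl, 2dr, 2rd, 3ru, 3ur, 4ul, 4lu$. * Each even length $n\ge4$: * Type 1 (8 words), with $n=2k+4$, $k\ge0$: $1(ur)^kuld$, $1(ru)^krdl$, $2(ul)^kurd$, $2(lu)^kldr$, $3(dl)^kdru$, $3(ld)^klur$, $4(dr)^kdlu$, $4(rd)^krul$; * Type 2 (8 further words), with $n=2k+2$, $k\ge1$: $1l(dl)^k$, $1d(ld)^k$, $2r(dr)^k$, $2d(rd)^k$, $3r(ur)^k$, $3u(ru)^k$, $4l(ul)^k$, $4u(lu)^k$. * Each odd length $n\ge5$: * Type 1 (8 words), with $n=2k+3$, $k\ge1$: $1(ru)^kld$, $1(ur)^kdl$, $2(lu)^krd$, $2(ul)^kdr$, $3(ld)^kru$, $3(dl)^kur$, $4(rd)^klu$, $4(dr)^kul$; * Type 2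 (8 further words), with $n=2k+1$, $k\ge2$: $1(ld)^k$, $1(dl)^k$, $2(rd)^k$, $2(dr)^k$, $3(ru)^k$, $3(ur)^k$, $4(lu)^k$, $4(ul)^k$. **(B)** Every collision is contained in a maximal one, all words of a collision have the same length, and the maximal collisions are exactly the following. * Length $1$: none. * Length $2$ (4 pairs): $\{1u,1r\}$, $\{2l,2u\}$, $\{3d,3l\}$, $\{4r,4d\}$. * Length $3$ (8 pairs): $\{1ul,2ru\}$, $\{1rd,4ur\}$, $\{2ur,1lu\}$, $\{2ld,3ul\}$, $\{3lu,2dl\}$, $\{3dr,4ld\}$, $\{4ru,1dr\}$, $\{4dl,3rd\}$. * Length $4$ (2 quadruples): $\{1ldr,2dru,3rul,4uld\}$, $\{1dlu,2rdl,3urd,4lur\}$. * Length $5$: * pathological (4 pairs): $\{1uldl,3luru\}$, $\{1rdld,3drur\}$, $\{2urdr,4rulu\}$, $\{2ldrd,4dlul\}$; * regular (8 further pairs): $\{1ldlu,2dlur\}$, $\{1dldr,4ldru\}$, $\{2rdru,1drul\}$, $\{2drdl,3rdlu\}$, $\{3urul,2ruld\}$, $\{3rurd,4urdl\}$, $\{4luld,3uldr\}$,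 $\{4ulur,1lurd\}$. * Each even length $n\ge6$ (8 pairs), with $n=2k+4$, $k\ge1$: $\{1(ld)^{k+1}r,\,2(dl)^kdru\}$, $\{1(dl)^{k+1}u,\,4(ld)^klur\}$, $\{2(dr)^{k+1}u,\,3(rd)^krul\}$, $\{2(rd)^{k+1}l,\,1(dr)^kdlu\}$, $\{3(ru)^{k+1}l,\,4(ur)^kuld\}$, $\{3(ur)^{k+1}d,\,2(ru)^krdl\}$, $\{4(ul)^{k+1}d,\,1(lu)^kldr\}$, $\{4(lu)^{k+1}r,\,3(ul)^kurd\}$. * Each odd length $n\ge7$ (8 pairs), with $n=2k+3$, $k\ge2$: $\{1(ld)^klu,\,2(dl)^kur\}$, $\{1(dl)^kdr,\,4(ld)^kru\}$, $\{2(dr)^kdl,\,3(rd)^klu\}$, $\{2(rd)^kru,\,1(dr)^kul\}$, $\{3(ru)^krd,\,4(ur)^kdl\}$, $\{3(ur)^kul,\,2(ru)^kld\}$, $\{4(ul)^kur,\,1(lu)^krd\}$, $\{4(lu)^kld,\,3(ul)^kdr\}$. -/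

import Mathlib

namespace PinClass

/-! ### Centred permutations and the box sum -/

/-- A centred permutation of length `n`: a permutation of `n + 1` points, written in one-line
notation as `perm 0, perm 1, …, perm n`, one of whose points (the one in position `origin`, at
height `perm origin`) is designated as the origin and does not count towards the length. -/
structure CentredPerm where
  length : ℕ
  perm : Equiv.Perm (Fin (length + 1))
  origin : Fin (length + 1)

/-- Inflating the point `a` of an `(n + 1)`-element chain by an `(m + 1)`-element chain gives an
`(m + n + 1)`-element chain: the new chain occupies the places `a, …, a + m`, and the old elements
other than `a` keep their place if they are below `a` and move up by `m` if they are above `a`. -/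
def inflateFun (m : ℕ) {n : ℕ} (a : Fin (n + 1)) :
    Fin (m + 1) ⊕ {i : Fin (n + 1) // i ≠ a} → Fin (m + n + 1)
  | .inl i => ⟨a + i, by omega⟩
  | .inr i => if i.1 < a then ⟨i.1, by omega⟩ else ⟨i.1 + m, by omega⟩

theorem inflateFun_bijective (m : ℕ) {n : ℕ} (a : Fin (n + 1)) :
    Function.Bijective (inflateFun m a) := by
  rw [Fintype.bijective_iff_injective_and_card]
  constructor
  · rintro (i | ⟨i, hi⟩) (j | ⟨j, hj⟩) h
    · simp only [inflateFun, Fin.mk.injEq] at h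
      congr 1; ext; omega
    · simp only [inflateFun] at h
      have hj' : (j : ℕ) ≠ a := fun e => hj (Fin.ext e)
      split_ifs at h with h1 <;> simp only [Fin.mk.injEq, Fin.lt_def] at h h1 <;> omega
    · simp only [inflateFun] at h
      have hi' : (i : ℕ) ≠ a := fun e => hi (Fin.ext e)
      split_ifs at h with h1 <;> simp only [Fin.mk.injEq, Fin.lt_def] at h h1 <;> omega
    · simp only [inflateFun] at h
      have hi' : (i : ℕ) ≠ a := fun e => hi (Fin.ext e)
      have hj' : (j : ℕ) ≠ a := fun e => hj (Fin.ext e)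
      congr 2
      ext
      split_ifs at h with h1 h2 h2 <;>
        simp only [Fin.mk.injEq, Fin.lt_def] at h h1 h2 <;> omega
  · simp only [Fintype.card_sum, Fintype.card_fin, ne_eq, Fintype.card_subtype_compl,
      Fintype.card_unique]
    omega

/-- `inflateFun` as a bijection. -/
noncomputable def inflate (m : ℕ) {n : ℕ} (a : Fin (n + 1)) :
    Fin (m + 1) ⊕ {i : Fin (n + 1) // i ≠ a} ≃ Fin (m + n + 1) :=
  Equiv.ofBijective (inflateFun m a) (inflateFun_bijective m a)

/-- The box sum `π ⊞ σ`: the origin of `σ` is inflated (both horizontally, at its position, and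
vertically, at its height) by a copy of `π`, and the origin of the copy of `π` is the origin of the
result. -/
noncomputable def CentredPerm.boxSum (π σ : CentredPerm) : CentredPerm where
  length := π.length + σ.length
  perm := ((inflate π.length σ.origin).symm.trans
    (Equiv.sumCongr π.perm
      (σ.perm.subtypeEquiv fun _ => not_congr σ.perm.injective.eq_iff.symm))).trans
    (inflate π.length (σ.perm σ.origin))
  origin := inflate π.length σ.origin (.inl π.origin)

/-- A centred permutation is `⊞`-decomposable if it is the box sum of two smaller ones. -/
def CentredPerm.IsBoxDecomposable (τ : CentredPerm) : Prop :=
  ∃ π σ : CentredPerm, π.length < τ.length ∧ σ.length < τ.length ∧ τ = π.boxSum σ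

/-- The centred permutation read off from the points `(x 0, y 0), …, (x n, y n)`, where no two
points share a coordinate and the point with index `0` is the origin. Here `Tuple.sort x` sends
`i` to the index of the `i`-th point from the left, and `(Tuple.sort y).symm` sends the
index of a point to its height. -/
def CentredPerm.ofPoints {n : ℕ} (x y : Fin (n + 1) → ℤ) : CentredPerm where
  length := n
  perm := (Tuple.sort x).trans (Tuple.sort y).symm
  origin := (Tuple.sort x).symm 0

/-! ### Pin words -/

/-- The four quadrants, numbered anticlockwise from the upper right one. -/
inductive Quadrant
  | one | two | three | four
  deriving DecidableEq

/-- The letters up, down, left, right. -/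
inductive Letter
  | u | d | l | r
  deriving DecidableEq

/-- `u` and `d` are the vertical letters. -/
def Letter.isVertical : Letter → Bool
  | .u => true
  | .d => true
  | .l => false
  | .r => false

/-- A numeral in `{1, 2, 3, 4}` followed by a finite list of letters. -/
structure Word where
  numeral : Quadrant
  letters : List Letter
  deriving DecidableEq

/-- The numeral counts as the first symbol. -/
def Word.length (w : Word) : ℕ := w.letters.length + 1

/-- A pin word is a numeral followed by letters alternating between vertical and horizontal. -/
def Word.IsPinWord (w : Word) : Prop :=
  w.letters.IsChain fun a b => a.isVertical ≠ b.isVertical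

/-! ### The centred permutation generated by a pin word -/

def Quadrant.signX : Quadrant → ℤ
  | .one => 1
  | .two => -1
  | .three => -1
  | .four => 1

def Quadrant.signY : Quadrant → ℤ
  | .one => 1
  | .two => 1
  | .three => -1
  | .four => -1

/-- Explicit coordinates for the points `p 0, p 1, …` placed according to a pin word. The origin
`p 0` is `(0, 0)`, and `p 1` is `(± 2, ± 2)` in the quadrant given by the numeral. For `k ≥ 2` the
point `p k`, placed say up or down, gets ordinate `± 2 k`, beyond all previous points, and abscissa
`± (2 k - 3)`, with the sign of the abscissa `± (2 k - 2)` of `p (k - 1)`; so it separates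
`p (k - 1)` from the previous points, whose abscissae are at most `2 k - 4` in absolute value.
`pinPoint_isPinDrawing` and `IsPinDrawing.lt_iff` below show that these points follow the
procedure that defines pin permutations, and that any other choice of points which does so gives
the same centred permutation. -/
def pinPoint (w : Word) : ℕ → ℤ × ℤ
  | 0 => (0, 0)
  | 1 => (2 * w.numeral.signX, 2 * w.numeral.signY)
  | k + 2 =>
    match w.letters.getD k .u with
    | .u => ((pinPoint w (k + 1)).1.sign * (2 * k + 1), 2 * (k + 2))
    | .d => ((pinPoint w (k + 1)).1.sign * (2 * k + 1), -(2 * (k + 2)))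
    | .l => (-(2 * (k + 2)), (pinPoint w (k + 1)).2.sign * (2 * k + 1))
    | .r => (2 * (k + 2), (pinPoint w (k + 1)).2.sign * (2 * k + 1))

/-- The centred permutation `π°_w` generated by a pin word `w`. -/
def Word.pinPerm (w : Word) : CentredPerm :=
  CentredPerm.ofPoints (n := w.length)
    (fun i => (pinPoint w i).1) (fun i => (pinPoint w i).2)

/-- `x k` lies strictly between `x (k - 1)` and all of `x 0, …, x (k - 2)`. -/
def SeparatesLast {α : Type*} [LinearOrder α] (x : ℕ → α) (k : ℕ) : Prop :=
  (x k < x (k - 1) ∧ ∀ j < k - 1, x j < x k) ∨ (x (k - 1) < x k ∧ ∀ j < k - 1, x k < x j)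

/-- The points with coordinates `(x k, y k)` are placed according to the word `w`:
`p 1` lies in the prescribed quadrant about `p 0`, and each further point is placed in the
prescribed direction from the bounding rectangle of all previous points, separating the last
point from all points before it. -/
structure IsPinDrawing {α : Type*} [LinearOrder α] (w : Word) (x y : ℕ → α) : Prop where
  first : match w.numeral with
    | .one => x 0 < x 1 ∧ y 0 < y 1
    | .two => x 1 < x 0 ∧ y 0 < y 1
    | .three => x 1 < x 0 ∧ y 1 < y 0
    | .four => x 0 < x 1 ∧ y 1 < y 0
  next : ∀ k (hk : k < w.letters.length), match w.letters[k] with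
    | .u => (∀ j < k + 2, y j < y (k + 2)) ∧ SeparatesLast x (k + 2)
    | .d => (∀ j < k + 2, y (k + 2) < y j) ∧ SeparatesLast x (k + 2)
    | .l => (∀ j < k + 2, x (k + 2) < x j) ∧ SeparatesLast y (k + 2)
    | .r => (∀ j < k + 2, x j < x (k + 2)) ∧ SeparatesLast y (k + 2)

theorem pinPoint_bounds (w : Word) (k : ℕ) :
    |(pinPoint w k).1| ≤ 2 * k ∧ |(pinPoint w k).2| ≤ 2 * k ∧
      (0 < k → (pinPoint w k).1 ≠ 0 ∧ (pinPoint w k).2 ≠ 0) := by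
  induction k using Nat.strong_induction_on with
  | _ k ih =>
    match k with
    | 0 => simp [pinPoint]
    | 1 => rcases h : w.numeral <;> simp [pinPoint, h, Quadrant.signX, Quadrant.signY]
    | k + 2 =>
      obtain ⟨-, -, h⟩ := ih (k + 1) (by omega)
      obtain ⟨h1, h2⟩ := h (by omega)
      simp only [pinPoint]
      rcases lt_or_gt_of_ne h1 with h1 | h1 <;> rcases lt_or_gt_of_ne h2 with h2 | h2 <;>
        rcases w.letters.getD k .u <;>
        simp only [Int.sign_eq_neg_one_of_neg, Int.sign_eq_one_of_pos, h1, h2, abs_le] <;>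
        push_cast <;> refine ⟨⟨?_, ?_⟩, ⟨?_, ?_⟩, fun _ => ⟨?_, ?_⟩⟩ <;> omega

theorem pinPoint_last (w : Word) (hw : w.IsPinWord) (k : ℕ) (hk : k < w.letters.length) :
    (w.letters[k].isVertical = true → |(pinPoint w (k + 1)).1| = 2 * (k + 1)) ∧
      (w.letters[k].isVertical = false → |(pinPoint w (k + 1)).2| = 2 * (k + 1)) := by
  cases k with
  | zero => rcases h : w.numeral <;> simp [pinPoint, h, Quadrant.signX, Quadrant.signY]
  | succ k =>
    have h := List.isChain_iff_getElem.1 hw k hk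
    have hg : w.letters.getD k .u = w.letters[k] := by
      simp [List.getD_eq_getElem?_getD, List.getElem?_eq_getElem (show k < w.letters.length by omega)]
    have habs : |2 * ((k : ℤ) + 2)| = 2 * (k + 2) := abs_of_nonneg (by omega)
    simp only [pinPoint, hg]
    generalize w.letters[k] = a at h ⊢
    generalize w.letters[k + 1] = b at h ⊢
    rcases a <;> rcases b <;> simp_all [Letter.isVertical] <;>
      (rw [abs_of_nonneg habs]; ring)

theorem separatesLast_of_bounds (x : ℕ → ℤ) (k : ℕ) (hb : ∀ j ≤ k, |x j| ≤ 2 * j)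
    (hl : |x (k + 1)| = 2 * (k + 1)) (hx : x (k + 2) = (x (k + 1)).sign * (2 * k + 1)) :
    SeparatesLast x (k + 2) := by
  have hj : ∀ j < k + 1, -(2 * (k : ℤ)) ≤ x j ∧ x j ≤ 2 * k := fun j hj => by
    have := abs_le.1 (hb j (by omega)); omega
  rcases abs_cases (x (k + 1)) with ⟨h1, h2⟩ | ⟨h1, h2⟩
  · rw [Int.sign_eq_one_of_pos (by omega)] at hx
    exact Or.inl ⟨by simp only [Nat.add_one_sub_one]; omega, fun j h => by
      have := hj j h; omega⟩
  · rw [Int.sign_eq_neg_one_of_neg h2] at hx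
    exact Or.inr ⟨by simp only [Nat.add_one_sub_one]; omega, fun j h => by
      have := hj j h; omega⟩

/-- The explicit points of a pin word are placed according to the pin word. -/
theorem pinPoint_isPinDrawing (w : Word) (hw : w.IsPinWord) :
    IsPinDrawing w (fun k => (pinPoint w k).1) (fun k => (pinPoint w k).2) where
  first := by
    rcases h : w.numeral <;> simp [pinPoint, h, Quadrant.signX, Quadrant.signY]
  next k hk := by
    obtain ⟨hv, hh⟩ := pinPoint_last w hw k hk
    have hg : w.letters.getD k .u = w.letters[k] := by
      simp [List.getD_eq_getElem?_getD, List.getElem?_eq_getElem hk]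
    have hb1 : ∀ j, |(pinPoint w j).1| ≤ 2 * j := fun j => (pinPoint_bounds w j).1
    have hb2 : ∀ j, |(pinPoint w j).2| ≤ 2 * j := fun j => (pinPoint_bounds w j).2.1
    have hp := pinPoint.eq_3 w k
    rw [hg] at hp
    rcases hc : w.letters[k] <;> simp only [hc] at hp hv hh ⊢ <;>
      refine ⟨fun j hj => ?_, separatesLast_of_bounds _ k (fun j _ => ?_) ?_ ?_⟩
    all_goals first
      | exact hb1 _
      | exact hb2 _
      | exact hv rfl
      | exact hh rfl
      | (simp only [hp]; done)
      | (have := abs_le.1 (hb1 j); have := abs_le.1 (hb2 j); simp only [hp]; omega)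

/-- Two ways of placing points according to the same word agree in the left-to-right and the
bottom-to-top order of their points. -/
theorem IsPinDrawing.lt_iff {α β : Type*} [LinearOrder α] [LinearOrder β] {w : Word}
    {x y : ℕ → α} {x' y' : ℕ → β} (h : IsPinDrawing w x y) (h' : IsPinDrawing w x' y')
    (i j : ℕ) (hi : i ≤ w.length) (hj : j ≤ w.length) :
    (x i < x j ↔ x' i < x' j) ∧ (y i < y j ↔ y' i < y' j) := by
  have top : ∀ {γ δ : Type _} [LinearOrder γ] [LinearOrder δ] (f : ℕ → γ) (g : ℕ → δ) (k : ℕ),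
      (∀ i < k, ∀ j < k, f i < f j ↔ g i < g j) → (∀ j < k, f j < f k) → (∀ j < k, g j < g k) →
      ∀ i < k + 1, ∀ j < k + 1, f i < f j ↔ g i < g j := by
    intro γ δ _ _ f g k ih hf hg i hi j hj
    rcases Nat.lt_succ_iff_lt_or_eq.1 hi with hi | rfl <;>
      rcases Nat.lt_succ_iff_lt_or_eq.1 hj with hj | rfl
    · exact ih i hi j hj
    · exact iff_of_true (hf i hi) (hg i hi)
    · exact iff_of_false (hf j hj).not_gt (hg j hj).not_gt
    · simp
  have bot : ∀ {γ δ : Type _} [LinearOrder γ] [LinearOrder δ] (f : ℕ → γ) (g : ℕ → δ) (k : ℕ),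
      (∀ i < k, ∀ j < k, f i < f j ↔ g i < g j) → (∀ j < k, f k < f j) → (∀ j < k, g k < g j) →
      ∀ i < k + 1, ∀ j < k + 1, f i < f j ↔ g i < g j := by
    intro γ δ _ _ f g k ih hf hg i hi j hj
    rcases Nat.lt_succ_iff_lt_or_eq.1 hi with hi | rfl <;>
      rcases Nat.lt_succ_iff_lt_or_eq.1 hj with hj | rfl
    · exact ih i hi j hj
    · exact iff_of_false (hf i hi).not_gt (hg i hi).not_gt
    · exact iff_of_true (hf j hj) (hg j hj)
    · simp
  have sep : ∀ {γ δ : Type _} [LinearOrder γ] [LinearOrder δ] (f : ℕ → γ) (g : ℕ → δ) (k : ℕ),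
      (∀ i < k + 2, ∀ j < k + 2, f i < f j ↔ g i < g j) → SeparatesLast f (k + 2) →
      SeparatesLast g (k + 2) → ∀ i < k + 3, ∀ j < k + 3, f i < f j ↔ g i < g j := by
    intro γ δ _ _ f g k ih hf hg
    have e := ih 0 (by omega) (k + 1) (by omega)
    have key : ∀ i < k + 2, (f i < f (k + 2) ↔ g i < g (k + 2)) ∧
        (f (k + 2) < f i ↔ g (k + 2) < g i) := by
      intro i hi
      simp only [SeparatesLast, Nat.add_one_sub_one] at hf hg
      rcases hf with ⟨hf1, hf2⟩ | ⟨hf1, hf2⟩ <;> rcases hg with ⟨hg1, hg2⟩ | ⟨hg1, hg2⟩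
      · rcases Nat.lt_succ_iff_lt_or_eq.1 hi with hi | rfl
        · exact ⟨iff_of_true (hf2 i hi) (hg2 i hi),
            iff_of_false (hf2 i hi).not_gt (hg2 i hi).not_gt⟩
        · exact ⟨iff_of_false hf1.not_gt hg1.not_gt, iff_of_true hf1 hg1⟩
      · exact absurd (e.1 ((hf2 0 (by omega)).trans hf1)) (hg1.trans (hg2 0 (by omega))).not_gt
      · exact absurd (e.2 ((hg2 0 (by omega)).trans hg1)) (hf1.trans (hf2 0 (by omega))).not_gt
      · rcases Nat.lt_succ_iff_lt_or_eq.1 hi with hi | rfl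
        · exact ⟨iff_of_false (hf2 i hi).not_gt (hg2 i hi).not_gt,
            iff_of_true (hf2 i hi) (hg2 i hi)⟩
        · exact ⟨iff_of_true hf1 hg1, iff_of_false hf1.not_gt hg1.not_gt⟩
    intro i hi j hj
    rcases Nat.lt_succ_iff_lt_or_eq.1 hi with hi | rfl <;>
      rcases Nat.lt_succ_iff_lt_or_eq.1 hj with hj | rfl
    · exact ih i hi j hj
    · exact (key i hi).1
    · exact (key j hj).2
    · simp
  have main : ∀ k ≤ w.letters.length,
      (∀ i < k + 2, ∀ j < k + 2, x i < x j ↔ x' i < x' j) ∧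
      (∀ i < k + 2, ∀ j < k + 2, y i < y j ↔ y' i < y' j) := by
    intro k
    induction k with
    | zero =>
      intro _
      have h1 := h.first
      have h2 := h'.first
      rcases hq : w.numeral <;> simp only [hq] at h1 h2 <;> constructor <;>
        intro i hi j hj <;> interval_cases i <;> interval_cases j <;>
        first
          | exact iff_of_true h1.1 h2.1
          | exact iff_of_true h1.2 h2.2
          | exact iff_of_false h1.1.not_gt h2.1.not_gt
          | exact iff_of_false h1.2.not_gt h2.2.not_gt
          | exact iff_of_false (lt_irrefl _) (lt_irrefl _)
    | succ k ih =>
      intro hk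
      obtain ⟨ihx, ihy⟩ := ih (by omega)
      have h1 := h.next k hk
      have h2 := h'.next k hk
      rcases hc : w.letters[k] <;> simp only [hc] at h1 h2
      · exact ⟨sep x x' k ihx h1.2 h2.2, top y y' (k + 2) ihy h1.1 h2.1⟩
      · exact ⟨sep x x' k ihx h1.2 h2.2, bot y y' (k + 2) ihy h1.1 h2.1⟩
      · exact ⟨bot x x' (k + 2) ihx h1.1 h2.1, sep y y' k ihy h1.2 h2.2⟩
      · exact ⟨top x x' (k + 2) ihx h1.1 h2.1, sep y y' k ihy h1.2 h2.2⟩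
  have hm := main _ le_rfl
  simp only [Word.length] at hi hj
  exact ⟨hm.1 i (by omega) j (by omega), hm.2 i (by omega) j (by omega)⟩

/-! ### The tables -/

/-- `f` repeated `k` times. -/
def rep (f : List Letter) (k : ℕ) : List Letter := (List.replicate k f).flatten

section Tables

open Quadrant Letter

def decomposables2 : Set Word :=
  {⟨one, [l]⟩, ⟨one, [d]⟩, ⟨two, [r]⟩, ⟨two, [d]⟩,
   ⟨three, [u]⟩, ⟨three, [r]⟩, ⟨four, [l]⟩, ⟨four, [u]⟩}

def decomposables3 : Set Word :=
  {⟨one, [l, d]⟩, ⟨one, [d, l]⟩, ⟨two, [d, r]⟩, ⟨two, [r, d]⟩,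
   ⟨three, [r, u]⟩, ⟨three, [u, r]⟩, ⟨four, [u, l]⟩, ⟨four, [l, u]⟩}

/-- Words of length `2 k + 4`. -/
def type1Even (k : ℕ) : Set Word :=
  {⟨one, rep [u, r] k ++ [u, l, d]⟩, ⟨one, rep [r, u] k ++ [r, d, l]⟩,
   ⟨two, rep [u, l] k ++ [u, r, d]⟩, ⟨two, rep [l, u] k ++ [l, d, r]⟩,
   ⟨three, rep [d, l] k ++ [d, r, u]⟩, ⟨three, rep [l, d] k ++ [l, u, r]⟩,
   ⟨four, rep [d, r] k ++ [d, l, u]⟩, ⟨four, rep [r, d] k ++ [r, u, l]⟩}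

/-- Words of length `2 k + 3`. -/
def type1Odd (k : ℕ) : Set Word :=
  {⟨one, rep [r, u] k ++ [l, d]⟩, ⟨one, rep [u, r] k ++ [d, l]⟩,
   ⟨two, rep [l, u] k ++ [r, d]⟩, ⟨two, rep [u, l] k ++ [d, r]⟩,
   ⟨three, rep [l, d] k ++ [r, u]⟩, ⟨three, rep [d, l] k ++ [u, r]⟩,
   ⟨four, rep [r, d] k ++ [l, u]⟩, ⟨four, rep [d, r] k ++ [u, l]⟩}

/-- Words of length `2 k + 2`. -/
def type2Even (k : ℕ) : Set Word :=
  {⟨one, [l] ++ rep [d, l] k⟩, ⟨one, [d] ++ rep [l, d] k⟩,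
   ⟨two, [r] ++ rep [d, r] k⟩, ⟨two, [d] ++ rep [r, d] k⟩,
   ⟨three, [r] ++ rep [u, r] k⟩, ⟨three, [u] ++ rep [r, u] k⟩,
   ⟨four, [l] ++ rep [u, l] k⟩, ⟨four, [u] ++ rep [l, u] k⟩}

/-- Words of length `2 k + 1`. -/
def type2Odd (k : ℕ) : Set Word :=
  {⟨one, rep [l, d] k⟩, ⟨one, rep [d, l] k⟩,
   ⟨two, rep [r, d] k⟩, ⟨two, rep [d, r] k⟩,
   ⟨three, rep [r, u] k⟩, ⟨three, rep [u, r] k⟩,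
   ⟨four, rep [l, u] k⟩, ⟨four, rep [u, l] k⟩}

def collisions2 : Set (Set Word) :=
  {{⟨one, [u]⟩, ⟨one, [r]⟩}, {⟨two, [l]⟩, ⟨two, [u]⟩},
   {⟨three, [d]⟩, ⟨three, [l]⟩}, {⟨four, [r]⟩, ⟨four, [d]⟩}}

def collisions3 : Set (Set Word) :=
  {{⟨one, [u, l]⟩, ⟨two, [r, u]⟩}, {⟨one, [r, d]⟩, ⟨four, [u, r]⟩},
   {⟨two, [u, r]⟩, ⟨one, [l, u]⟩}, {⟨two, [l, d]⟩, ⟨three, [u, l]⟩},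
   {⟨three, [l, u]⟩, ⟨two, [d, l]⟩}, {⟨three, [d, r]⟩, ⟨four, [l, d]⟩},
   {⟨four, [r, u]⟩, ⟨one, [d, r]⟩}, {⟨four, [d, l]⟩, ⟨three, [r, d]⟩}}

def collisions4 : Set (Set Word) :=
  {{⟨one, [l, d, r]⟩, ⟨two, [d, r, u]⟩, ⟨three, [r, u, l]⟩, ⟨four, [u, l, d]⟩},
   {⟨one, [d, l, u]⟩, ⟨two, [r, d, l]⟩, ⟨three, [u, r, d]⟩, ⟨four, [l, u, r]⟩}}

def pathologicalCollisions5 : Set (Set Word) :=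
  {{⟨one, [u, l, d, l]⟩, ⟨three, [l, u, r, u]⟩},
   {⟨one, [r, d, l, d]⟩, ⟨three, [d, r, u, r]⟩},
   {⟨two, [u, r, d, r]⟩, ⟨four, [r, u, l, u]⟩},
   {⟨two, [l, d, r, d]⟩, ⟨four, [d, l, u, l]⟩}}

def regularCollisions5 : Set (Set Word) :=
  {{⟨one, [l, d, l, u]⟩, ⟨two, [d, l, u, r]⟩},
   {⟨one, [d, l, d, r]⟩, ⟨four, [l, d, r, u]⟩},
   {⟨two, [r, d, r, u]⟩, ⟨one, [d, r, u, l]⟩},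
   {⟨two, [d, r, d, l]⟩, ⟨three, [r, d, l, u]⟩},
   {⟨three, [u, r, u, l]⟩, ⟨two, [r, u, l, d]⟩},
   {⟨three, [r, u, r, d]⟩, ⟨four, [u, r, d, l]⟩},
   {⟨four, [l, u, l, d]⟩, ⟨three, [u, l, d, r]⟩},
   {⟨four, [u, l, u, r]⟩, ⟨one, [l, u, r, d]⟩}}

/-- Pairs of words of length `2 k + 4`. -/
def collisionsEven (k : ℕ) : Set (Set Word) :=
  {{⟨one, rep [l, d] (k + 1) ++ [r]⟩, ⟨two, rep [d, l] k ++ [d, r, u]⟩},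
   {⟨one, rep [d, l] (k + 1) ++ [u]⟩, ⟨four, rep [l, d] k ++ [l, u, r]⟩},
   {⟨two, rep [d, r] (k + 1) ++ [u]⟩, ⟨three, rep [r, d] k ++ [r, u, l]⟩},
   {⟨two, rep [r, d] (k + 1) ++ [l]⟩, ⟨one, rep [d, r] k ++ [d, l, u]⟩},
   {⟨three, rep [r, u] (k + 1) ++ [l]⟩, ⟨four, rep [u, r] k ++ [u, l, d]⟩},
   {⟨three, rep [u, r] (k + 1) ++ [d]⟩, ⟨two, rep [r, u] k ++ [r, d, l]⟩},
   {⟨four, rep [u, l] (k + 1) ++ [d]⟩, ⟨one, rep [l, u] k ++ [l, d, r]⟩},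
   {⟨four, rep [l, u] (k + 1) ++ [r]⟩, ⟨three, rep [u, l] k ++ [u, r, d]⟩}}

/-- Pairs of words of length `2 k + 3`. -/
def collisionsOdd (k : ℕ) : Set (Set Word) :=
  {{⟨one, rep [l, d] k ++ [l, u]⟩, ⟨two, rep [d, l] k ++ [u, r]⟩},
   {⟨one, rep [d, l] k ++ [d, r]⟩, ⟨four, rep [l, d] k ++ [r, u]⟩},
   {⟨two, rep [d, r] k ++ [d, l]⟩, ⟨three, rep [r, d] k ++ [l, u]⟩},
   {⟨two, rep [r, d] k ++ [r, u]⟩, ⟨one, rep [d, r] k ++ [u, l]⟩},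
   {⟨three, rep [r, u] k ++ [r, d]⟩, ⟨four, rep [u, r] k ++ [d, l]⟩},
   {⟨three, rep [u, r] k ++ [u, l]⟩, ⟨two, rep [r, u] k ++ [l, d]⟩},
   {⟨four, rep [u, l] k ++ [u, r]⟩, ⟨one, rep [l, u] k ++ [r, d]⟩},
   {⟨four, rep [l, u] k ++ [l, d]⟩, ⟨three, rep [u, l] k ++ [d, r]⟩}}

end Tables

/-! ### Decomposable pin words and collisions -/

/-- The `⊞`-decomposable pin words of length `n`. -/
def boxDecomposables (n : ℕ) : Set Word :=
  {w | w.IsPinWord ∧ w.length = n ∧ w.pinPerm.IsBoxDecomposable}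

/-- A collision is a set of at least two pin words which generate the same centred permutation. -/
def IsCollision (S : Set Word) : Prop :=
  S.Nontrivial ∧ (∀ w ∈ S, w.IsPinWord) ∧ ∃ σ : CentredPerm, ∀ w ∈ S, w.pinPerm = σ

/-- The maximal collisions among pin words of length `n`. -/
def maximalCollisions (n : ℕ) : Set (Set Word) :=
  {S | Maximal IsCollision S ∧ ∀ w ∈ S, w.length = n}

end PinClass

namespace PinClass

/-! ### Models of centred permutations -/

/-! A centred permutation is the order type of a marked point set, so all questions become questions
about points. Letters alternate, so pins of even index are placed along one axis and those of odd
index along the other; a pin word is a choice of the vertical axis and of signs `e 0, …, e n`. Along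
the axis `π` the pins fall into pairs `{m, m + 1}` with `m ≡ π` mod 2. A pair lies on the side `e m`
of the origin, pin `m + 1` is just inside pin `m`, and later pairs are farther out. Every argument
uses only the relation `Outer`: same side, farther out.

(A) A box decomposition is a proper set of at least two points that contains the origin and is an
interval in both coordinates (`IsModel.isBoxDecomposable_iff`). Such a set is closed towards the
origin, and pin `k + 1` is inside pin `k` along one axis, so it consists of the origin and a final
segment `j, …, n` with no pin beyond any of `1, …, j - 1`. By `not_outer_iff_spiral` this forces `j
= 2` with all signs from index `2` on opposite to those of the first pin, or `j = n` with constant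
signs on each axis up to the last two, which are reversed.

(B) If two words give the same permutation, their pins correspond under a bijection `ψ`
(`PinMatch`). Among the pins up to `m`, none is beyond pin `m` along its own axis and only pin `m -
1` is beyond it along the other. Carried through `ψ`, this severely restricts the image of the last
pin. If `ψ n = n`, peeling off pins backwards shows that the words agree
(`PinMatch.eq_of_map_last`). If `ψ n = 1`, the first word turns once around the origin and the
second places its first pin last (`IsShift`). If `ψ n = 2` and `n ≥ 5`, then `n = 5` and the match
is the exceptional `IsTwist`; if `ψ n = 2` and `n = 4`, it is a composite of two shifts. The only
other possibility is `ψ n = n - 1`, and `ψ` and its inverse cannot both be of this kind. The shifts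
and twists do give equal permutations, and composing with their inverses reduces uniqueness to the
case `ψ n = n`.

Maximal collisions are the fibres with at least two words. For `n = 3` and `n ≥ 5` no word is both
the source and the target of a shift, whence pairs; for `n = 4` the shift acts on its eight words in
two cycles of length four. -/

theorem equiv_fin_eq_of_lt_iff {ι : Type*} {n : ℕ} {g g' : ι ≃ Fin n}
    (h : ∀ i j, g i < g j ↔ g' i < g' j) : g = g' := by
  let e : Fin n ≃o Fin n :=
    { g.symm.trans g' with
      map_rel_iff' := by
        intro a b
        have := h (g.symm b) (g.symm a)
        simp only [Equiv.apply_symm_apply] at this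
        exact not_lt.symm.trans ((not_congr this.symm).trans not_lt) }
  have he : e = OrderIso.refl _ := Subsingleton.elim _ _
  ext i
  have := congrArg (fun f : Fin n ≃o Fin n => (f (g i) : ℕ)) he
  simpa [e] using this.symm

/-- The points with coordinates `(x i, y i)` and the origin `o` have the relative order described
by `τ`. -/
def CentredPerm.IsModel (τ : CentredPerm) {ι : Type*} (x y : ι → ℤ) (o : ι) : Prop :=
  ∃ g : ι ≃ Fin (τ.length + 1), (∀ i j, x i < x j ↔ g i < g j) ∧
    (∀ i j, y i < y j ↔ τ.perm (g i) < τ.perm (g j)) ∧ g o = τ.origin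

/-- Ranks in a finite chain are determined by the order. Equalities of centred permutations are thus
proved by exhibiting a common set of points. -/
theorem CentredPerm.IsModel.unique {ι : Type*} {x y : ι → ℤ} {o : ι} {τ τ' : CentredPerm}
    (h : τ.IsModel x y o) (h' : τ'.IsModel x y o) : τ = τ' := by
  obtain ⟨n, p, a⟩ := τ
  obtain ⟨n', p', a'⟩ := τ'
  obtain ⟨g, gx, gy, go⟩ := h
  obtain ⟨g', gx', gy', go'⟩ := h'
  dsimp only at g gx gy go g' gx' gy' go'
  have hn : n = n' := by
    have := Fintype.card_congr (g.symm.trans g')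
    simpa using this
  subst hn
  obtain rfl : g = g' := equiv_fin_eq_of_lt_iff fun i j => (gx i j).symm.trans (gx' i j)
  have hp : g.trans p = g.trans p' :=
    equiv_fin_eq_of_lt_iff fun i j => (gy i j).symm.trans (gy' i j)
  obtain rfl : p = p' := by
    ext i
    have := Equiv.congr_fun hp (g.symm i)
    simpa using congrArg Fin.val this
  rw [← go, ← go']

theorem CentredPerm.IsModel.comp {ι κ : Type*} {x y : ι → ℤ} {x' y' : κ → ℤ} {o : ι} {o' : κ}
    {τ : CentredPerm} (h : τ.IsModel x' y' o') (φ : ι ≃ κ)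
    (hx : ∀ i j, x i < x j ↔ x' (φ i) < x' (φ j))
    (hy : ∀ i j, y i < y j ↔ y' (φ i) < y' (φ j)) (ho : φ o = o') : τ.IsModel x y o := by
  obtain ⟨g, gx, gy, go⟩ := h
  exact ⟨φ.trans g, fun i j => (hx i j).trans (gx _ _), fun i j => (hy i j).trans (gy _ _),
    by simp [ho, go]⟩

theorem CentredPerm.IsModel.exists_equiv {ι κ : Type*} {x y : ι → ℤ} {x' y' : κ → ℤ} {o : ι}
    {o' : κ} {τ : CentredPerm} (h : τ.IsModel x y o) (h' : τ.IsModel x' y' o') :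
    ∃ φ : ι ≃ κ, φ o = o' ∧ (∀ i j, x i < x j ↔ x' (φ i) < x' (φ j)) ∧
      (∀ i j, y i < y j ↔ y' (φ i) < y' (φ j)) := by
  obtain ⟨g, gx, gy, go⟩ := h
  obtain ⟨g', gx', gy', go'⟩ := h'
  refine ⟨g.trans g'.symm, ?_, fun i j => ?_, fun i j => ?_⟩
  · rw [Equiv.trans_apply, Equiv.symm_apply_eq, go, go']
  · simp [gx, gx']
  · simp [gy, gy']

theorem sort_symm_lt_iff {n : ℕ} {x : Fin n → ℤ} (hx : Function.Injective x) (i j : Fin n) :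
    x i < x j ↔ (Tuple.sort x).symm i < (Tuple.sort x).symm j := by
  have h : StrictMono (x ∘ Tuple.sort x) :=
    (Tuple.monotone_sort x).strictMono_of_injective (hx.comp (Tuple.sort x).injective)
  rw [← h.lt_iff_lt]
  simp

theorem CentredPerm.isModel_ofPoints {n : ℕ} {x y : Fin (n + 1) → ℤ} (hx : Function.Injective x)
    (hy : Function.Injective y) : (CentredPerm.ofPoints x y).IsModel x y 0 :=
  ⟨(Tuple.sort x).symm, sort_symm_lt_iff hx, fun i j => by
    change y i < y j ↔ (Tuple.sort y).symm (Tuple.sort x ((Tuple.sort x).symm i)) <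
      (Tuple.sort y).symm (Tuple.sort x ((Tuple.sort x).symm j))
    simpa using sort_symm_lt_iff hy i j, rfl⟩

theorem CentredPerm.exists_isModel {ι : Type*} [Finite ι] {x y : ι → ℤ}
    (hx : Function.Injective x) (hy : Function.Injective y) (o : ι) :
    ∃ τ : CentredPerm, τ.IsModel x y o := by
  classical
  obtain ⟨m, ⟨e⟩⟩ := Finite.exists_equiv_fin ι
  obtain ⟨n, rfl⟩ : ∃ n, m = n + 1 := ⟨m - 1, by have := (e o).pos; omega⟩
  -- `ofPoints` takes the point of index `0` as origin, so the enumeration is adjusted to send `o`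
  -- there.
  let φ : ι ≃ Fin (n + 1) := e.trans (Equiv.swap (e o) 0)
  refine ⟨_, (CentredPerm.isModel_ofPoints (hx.comp φ.symm.injective)
    (hy.comp φ.symm.injective)).comp φ ?_ ?_ ?_⟩
  · simp
  · simp
  · simp [φ]

/-! ### Box sums and intervals -/

section Inflate

variable {m n : ℕ} (a : Fin (n + 1))

theorem inflate_inl_lt_inl (i j : Fin (m + 1)) :
    inflate m a (.inl i) < inflate m a (.inl j) ↔ i < j := by
  simp only [inflate, inflateFun, Equiv.ofBijective_apply, Fin.lt_def]
  omega

theorem inflate_inl_lt_inr (i : Fin (m + 1)) (j : {j // j ≠ a}) :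
    inflate m a (.inl i) < inflate m a (.inr j) ↔ a < j.1 := by
  obtain ⟨j, hj⟩ := j
  have hj' : (j : ℕ) ≠ a := fun e => hj (Fin.ext e)
  simp only [inflate, inflateFun, Equiv.ofBijective_apply, Fin.lt_def]
  split_ifs <;> simp only <;> omega

theorem inflate_inr_lt_inl (i : Fin (m + 1)) (j : {j // j ≠ a}) :
    inflate m a (.inr j) < inflate m a (.inl i) ↔ j.1 < a := by
  obtain ⟨j, hj⟩ := j
  have hj' : (j : ℕ) ≠ a := fun e => hj (Fin.ext e)
  simp only [inflate, inflateFun, Equiv.ofBijective_apply, Fin.lt_def]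
  split_ifs <;> simp only <;> omega

theorem inflate_inr_lt_inr (i j : {j // j ≠ a}) :
    inflate m a (.inr i) < inflate m a (.inr j) ↔ i.1 < j.1 := by
  obtain ⟨i, hi⟩ := i
  obtain ⟨j, hj⟩ := j
  have hi' : (i : ℕ) ≠ a := fun e => hi (Fin.ext e)
  have hj' : (j : ℕ) ≠ a := fun e => hj (Fin.ext e)
  simp only [inflate, inflateFun, Equiv.ofBijective_apply, Fin.lt_def]
  split_ifs <;> simp only <;> omega

end Inflate

/-- The permutation underlying the box sum. -/
noncomputable def CentredPerm.boxPerm (π σ : CentredPerm) :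
    Equiv.Perm (Fin (π.length + σ.length + 1)) :=
  ((inflate π.length σ.origin).symm.trans
    (Equiv.sumCongr π.perm
      (σ.perm.subtypeEquiv fun _ => not_congr σ.perm.injective.eq_iff.symm))).trans
    (inflate π.length (σ.perm σ.origin))

theorem CentredPerm.isModel_boxSum_iff {ι : Type*} {x y : ι → ℤ} {o : ι} {π σ : CentredPerm} :
    (π.boxSum σ).IsModel x y o ↔ ∃ g : ι ≃ Fin (π.length + σ.length + 1),
      (∀ i j, x i < x j ↔ g i < g j) ∧
      (∀ i j, y i < y j ↔ π.boxPerm σ (g i) < π.boxPerm σ (g j)) ∧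
      g o = inflate π.length σ.origin (.inl π.origin) :=
  Iff.rfl

theorem CentredPerm.boxPerm_inl (π σ : CentredPerm) (i : Fin (π.length + 1)) :
    π.boxPerm σ (inflate π.length σ.origin (.inl i)) =
      inflate π.length (σ.perm σ.origin) (.inl (π.perm i)) := by
  simp [CentredPerm.boxPerm]

theorem CentredPerm.boxPerm_inr (π σ : CentredPerm) (i : {i // i ≠ σ.origin}) :
    π.boxPerm σ (inflate π.length σ.origin (.inr i)) =
      inflate π.length (σ.perm σ.origin)
        (.inr ⟨σ.perm i.1, fun h => i.2 (σ.perm.injective h)⟩) := by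
  simp [CentredPerm.boxPerm]

/-- No point outside `S` has its coordinate between those of two points of `S`. -/
def IsIntervalOn {ι : Type*} (S : Set ι) (x : ι → ℤ) : Prop :=
  ∀ s ∈ S, ∀ t ∈ S, ∀ u ∉ S, ¬ (x s < x u ∧ x u < x t)

theorem CentredPerm.IsModel.exists_interval {ι : Type*} {x y : ι → ℤ} {o : ι} {π σ : CentredPerm}
    (h : (π.boxSum σ).IsModel x y o) (hπ : 0 < π.length) (hσ : 0 < σ.length) :
    ∃ S : Set ι, o ∈ S ∧ S.Nontrivial ∧ Sᶜ.Nonempty ∧ IsIntervalOn S x ∧ IsIntervalOn S y := by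
  obtain ⟨g, gx, gy, go⟩ := CentredPerm.isModel_boxSum_iff.1 h
  have key : ∀ u, (¬ ∃ a, g u = inflate π.length σ.origin (.inl a)) →
      ∃ b, g u = inflate π.length σ.origin (.inr b) := by
    intro u hu
    obtain ⟨a | b, hb⟩ := (inflate π.length σ.origin).surjective (g u)
    · exact absurd ⟨a, hb.symm⟩ hu
    · exact ⟨b, hb.symm⟩
  refine ⟨{i | ∃ a, g i = inflate π.length σ.origin (.inl a)}, ⟨π.origin, go⟩, ?_, ?_, ?_, ?_⟩
  · refine ⟨g.symm (inflate π.length σ.origin (.inl 0)), ⟨0, by simp⟩,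
      g.symm (inflate π.length σ.origin (.inl (Fin.last _))), ⟨Fin.last _, by simp⟩, ?_⟩
    intro h
    have h := (inflate π.length σ.origin).injective (g.symm.injective h)
    have := congrArg Fin.val (Sum.inl_injective h)
    simp at this
    omega
  · have : Nontrivial (Fin (σ.length + 1)) := Fin.nontrivial_iff_two_le.2 (by omega)
    obtain ⟨b, hb⟩ := exists_ne σ.origin
    refine ⟨g.symm (inflate π.length σ.origin (.inr ⟨b, hb⟩)), ?_⟩
    rintro ⟨a, ha⟩
    rw [Equiv.apply_symm_apply] at ha
    exact absurd ((inflate π.length σ.origin).injective ha) (by simp)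
  · rintro s ⟨a, ha⟩ t ⟨b, hb⟩ u hu ⟨h1, h2⟩
    obtain ⟨c, hc⟩ := key u hu
    rw [gx, ha, hc, inflate_inl_lt_inr] at h1
    rw [gx, hb, hc, inflate_inr_lt_inl] at h2
    exact lt_asymm h1 h2
  · rintro s ⟨a, ha⟩ t ⟨b, hb⟩ u hu ⟨h1, h2⟩
    obtain ⟨c, hc⟩ := key u hu
    rw [gy, ha, hc, CentredPerm.boxPerm_inl, CentredPerm.boxPerm_inr,
      inflate_inl_lt_inr] at h1
    rw [gy, hb, hc, CentredPerm.boxPerm_inl, CentredPerm.boxPerm_inr,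
      inflate_inr_lt_inl] at h2
    exact lt_asymm h1 h2

/-- A point outside an interval has the whole interval on one side, so `o` can stand for any member.
-/
theorem lt_iff_of_isIntervalOn {ι : Type*} {S : Set ι} {x : ι → ℤ} (hx : Function.Injective x)
    (hS : IsIntervalOn S x) {o s u : ι} (ho : o ∈ S) (hs : s ∈ S) (hu : u ∉ S) :
    (x s < x u ↔ x o < x u) ∧ (x u < x s ↔ x u < x o) := by
  have h1 := hS s hs o ho u hu
  have h2 := hS o ho s hs u hu
  have h3 : x s ≠ x u := fun h => hu (hx h ▸ hs)
  have h4 : x o ≠ x u := fun h => hu (hx h ▸ ho)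
  omega

theorem inflate_lt_iff_of_isIntervalOn {ι : Type*} {S : Set ι} {x : ι → ℤ}
    (hx : Function.Injective x) (hS : IsIntervalOn S x) {o : ι} (ho : o ∈ S) {m n : ℕ}
    (a : Fin (n + 1)) {p : ι → Fin (m + 1)} {q : ι → Fin (n + 1)}
    (hp : ∀ i ∈ S, ∀ j ∈ S, x i < x j ↔ p i < p j)
    (hq : ∀ i, i = o ∨ i ∉ S → ∀ j, j = o ∨ j ∉ S → (x i < x j ↔ q i < q j)) (hqo : q o = a)
    (hqa : ∀ i, i ∉ S → q i ≠ a) {G : ι → Fin (m + n + 1)}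
    (hG : ∀ i ∈ S, G i = inflate m a (.inl (p i)))
    (hG' : ∀ i (hi : i ∉ S), G i = inflate m a (.inr ⟨q i, hqa i hi⟩)) (i j : ι) :
    x i < x j ↔ G i < G j := by
  by_cases hi : i ∈ S <;> by_cases hj : j ∈ S
  · rw [hG i hi, hG j hj, inflate_inl_lt_inl, hp i hi j hj]
  · rw [hG i hi, hG' j hj, inflate_inl_lt_inr, (lt_iff_of_isIntervalOn hx hS ho hi hj).1,
      hq o (.inl rfl) j (.inr hj), hqo]
  · rw [hG' i hi, hG j hj, inflate_inr_lt_inl, (lt_iff_of_isIntervalOn hx hS ho hj hi).2,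
      hq i (.inr hi) o (.inl rfl), hqo]
  · rw [hG' i hi, hG' j hj, inflate_inr_lt_inr, hq i (.inr hi) j (.inr hj)]

/-- The inflated copy of `π` is the interval. Conversely, `S` is read off as `π`, and its complement
together with `o`, which represents the collapsed `S`, is read off as `σ`. -/
theorem CentredPerm.IsModel.isBoxDecomposable_iff {ι : Type*} [Finite ι] {x y : ι → ℤ} {o : ι}
    {τ : CentredPerm} (h : τ.IsModel x y o) (hx : Function.Injective x)
    (hy : Function.Injective y) :
    τ.IsBoxDecomposable ↔
      ∃ S : Set ι, o ∈ S ∧ S.Nontrivial ∧ Sᶜ.Nonempty ∧ IsIntervalOn S x ∧ IsIntervalOn S y := by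
  classical
  constructor
  · rintro ⟨π, σ, hπ, hσ, rfl⟩
    have : (π.boxSum σ).length = π.length + σ.length := rfl
    exact h.exists_interval (by omega) (by omega)
  · rintro ⟨S, ho, hS, ⟨u, hu⟩, hSx, hSy⟩
    obtain ⟨π, gπ, πx, πy, πo⟩ := CentredPerm.exists_isModel (ι := S) (x := fun i => x i)
      (y := fun i => y i) (hx.comp Subtype.val_injective) (hy.comp Subtype.val_injective) ⟨o, ho⟩
    obtain ⟨σ, gσ, σx, σy, σo⟩ := CentredPerm.exists_isModel (ι := {i // i = o ∨ i ∉ S})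
      (x := fun i => x i) (y := fun i => y i) (hx.comp Subtype.val_injective)
      (hy.comp Subtype.val_injective) ⟨o, .inl rfl⟩
    let p : ι → Fin (π.length + 1) := fun i => if h : i ∈ S then gπ ⟨i, h⟩ else 0
    let q : ι → Fin (σ.length + 1) := fun i => if h : i = o ∨ i ∉ S then gσ ⟨i, h⟩ else 0
    have hp : ∀ i (h : i ∈ S), p i = gπ ⟨i, h⟩ := fun i h => by simp [p, h]
    have hq : ∀ i (h : i = o ∨ i ∉ S), q i = gσ ⟨i, h⟩ := fun i h => dif_pos h
    have hqo : q o = σ.origin := by rw [hq o (.inl rfl), σo]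
    have hqa : ∀ i, i ∉ S → q i ≠ σ.origin := by
      intro i hi e
      rw [hq i (.inr hi), ← σo] at e
      have : i = o := congrArg Subtype.val (gσ.injective e)
      exact hi (this ▸ ho)
    let G : ι → Fin (π.length + σ.length + 1) := fun i =>
      if hi : i ∈ S then inflate π.length σ.origin (.inl (p i))
      else inflate π.length σ.origin (.inr ⟨q i, hqa i hi⟩)
    have hG : ∀ i ∈ S, G i = inflate π.length σ.origin (.inl (p i)) := fun i hi => dif_pos hi
    have hG' : ∀ i (hi : i ∉ S), G i = inflate π.length σ.origin (.inr ⟨q i, hqa i hi⟩) :=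
      fun i hi => dif_neg hi
    have Gx : ∀ i j, x i < x j ↔ G i < G j :=
      inflate_lt_iff_of_isIntervalOn hx hSx ho σ.origin
        (fun i hi j hj => by rw [hp i hi, hp j hj, ← πx])
        (fun i hi j hj => by rw [hq i hi, hq j hj, ← σx]) hqo hqa hG hG'
    have Gy : ∀ i j, y i < y j ↔ π.boxPerm σ (G i) < π.boxPerm σ (G j) :=
      inflate_lt_iff_of_isIntervalOn (p := fun i => π.perm (p i)) (q := fun i => σ.perm (q i))
        hy hSy ho (σ.perm σ.origin)
        (fun i hi j hj => by rw [hp i hi, hp j hj, ← πy])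
        (fun i hi j hj => by rw [hq i hi, hq j hj, ← σy]) (by rw [hqo])
        (fun i hi e => hqa i hi (σ.perm.injective e))
        (G := fun i => π.boxPerm σ (G i))
        (fun i hi => by rw [hG i hi, CentredPerm.boxPerm_inl])
        (fun i hi => by rw [hG' i hi, CentredPerm.boxPerm_inr])
    have Ginj : Function.Injective G := fun i j e => by
      have h1 := Gx i j
      have h2 := Gx j i
      rw [e] at h1 h2
      exact hx (by simp only [lt_irrefl, iff_false] at h1 h2; omega)
    have Gsurj : Function.Surjective G := by
      intro c
      obtain ⟨a | ⟨b, hb⟩, rfl⟩ := (inflate π.length σ.origin).surjective c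
      · refine ⟨gπ.symm a, ?_⟩
        rw [hG _ (gπ.symm a).2, hp _ (gπ.symm a).2]
        simp
      · have hb' : (gσ.symm b).1 ∉ S := by
          rcases (gσ.symm b).2 with h | h
          · refine absurd ?_ hb
            rw [← σo, ← Equiv.symm_apply_eq]
            exact Subtype.ext h
          · exact h
        refine ⟨gσ.symm b, ?_⟩
        rw [hG' _ hb']
        simp only [hq _ (gσ.symm b).2, Subtype.coe_eta, Equiv.apply_symm_apply]
    -- The gluing `G` shows that the box sum is a model of the same points as `τ`.
    have hτ : τ = π.boxSum σ :=
      h.unique <| CentredPerm.isModel_boxSum_iff.2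
        ⟨Equiv.ofBijective G ⟨Ginj, Gsurj⟩, Gx, Gy, by
          change G o = _
          rw [hG o ho, hp o ho, πo]⟩
    have hl : τ.length = π.length + σ.length := by rw [hτ]; rfl
    have hπ : 0 < π.length := by
      obtain ⟨s, hs, t, ht, hst⟩ := hS
      by_contra hc
      have : gπ ⟨s, hs⟩ = gπ ⟨t, ht⟩ := by ext; omega
      exact hst (congrArg Subtype.val (gπ.injective this))
    have hσ : 0 < σ.length := by
      by_contra hc
      have : gσ ⟨o, .inl rfl⟩ = gσ ⟨u, .inr hu⟩ := by ext; omega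
      have : o = u := congrArg Subtype.val (gσ.injective this)
      exact hu (this ▸ ho)
    exact ⟨π, σ, by omega, by omega, hτ⟩

/-! ### Coordinates of pins in terms of signs

The pins with an even index are placed along one axis, those with an odd index along the other one.
An axis is named by a number of the same parity. A pin word amounts to the choice of the axis which
is vertical and of a sign `e k` for each `k ≥ 0`: for `k ≥ 2` it tells in which of the two
directions along the axis `k` the pin `k` is placed, and `e 0`, `e 1` are the signs of the first
pin along the axes `0` and `1`. -/

/-- The pin `k` has the sign `e (block π k)` along the axis `π`. -/
def block (π k : ℕ) : ℕ := if k % 2 = π % 2 then k else k - 1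

/-- The distance of the pin `k` from the origin along the axis `π`. -/
def mag (π k : ℕ) : ℕ := if k = 0 then 0 else if k % 2 = π % 2 then 2 * k + 2 else 2 * k - 1

/-- The coordinate of the pin `k` along the axis `π`. -/
def coord (e : ℕ → Bool) (π k : ℕ) : ℤ := if e (block π k) then mag π k else -mag π k

/-- Along the axis `π`, the pin `a` lies beyond the pin `m`, as seen from the origin. -/
def Outer (e : ℕ → Bool) (π a m : ℕ) : Prop :=
  m ≠ 0 ∧ e (block π a) = e (block π m) ∧ mag π m < mag π a

theorem mag_injective (π : ℕ) : Function.Injective (mag π) := by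
  intro a b h
  simp only [mag] at h
  split_ifs at h <;> omega

theorem mag_pos {π k : ℕ} (hk : k ≠ 0) : 0 < mag π k := by
  simp only [mag, hk, if_false]
  split_ifs <;> omega

@[simp] theorem mag_zero (π : ℕ) : mag π 0 = 0 := rfl

@[simp] theorem coord_zero (e : ℕ → Bool) (π : ℕ) : coord e π 0 = 0 := by simp [coord]

theorem coord_injective (e : ℕ → Bool) (π : ℕ) : Function.Injective (coord e π) := by
  intro a b h
  apply mag_injective π
  simp only [coord] at h
  split_ifs at h <;> omega

theorem coord_pos_iff (e : ℕ → Bool) (π : ℕ) {k : ℕ} (hk : k ≠ 0) :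
    0 < coord e π k ↔ e (block π k) = true := by
  have := mag_pos (π := π) hk
  simp only [coord]
  split_ifs with h <;> simp only [h, iff_true, iff_false, Bool.false_eq_true] <;> omega

/-- In this form `Outer` depends only on the order of the coordinates and on the origin, hence is
preserved by every order isomorphism fixing the origin. -/
theorem outer_iff_coord (e : ℕ → Bool) (π a m : ℕ) :
    Outer e π a m ↔ (0 < coord e π m ∧ coord e π m < coord e π a) ∨
      (coord e π m < 0 ∧ coord e π a < coord e π m) := by
  rcases Nat.eq_zero_or_pos m with rfl | hm
  · simp [Outer]
  · have := mag_pos (π := π) hm.ne'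
    simp only [Outer, coord]
    cases e (block π a) <;> cases e (block π m) <;> simp [hm.ne'] <;> omega

theorem block_congr {π π' : ℕ} (h : π % 2 = π' % 2) : block π = block π' := by
  funext k; simp [block, h]

theorem coord_congr (e : ℕ → Bool) {π π' : ℕ} (h : π % 2 = π' % 2) :
    coord e π = coord e π' := by
  funext k; simp [coord, mag, block, h]

theorem Outer.congr_axis {e : ℕ → Bool} {π π' a m : ℕ} (h : π % 2 = π' % 2) :
    Outer e π a m ↔ Outer e π' a m := by
  simp [outer_iff_coord, coord_congr e h]

theorem coord_last (e : ℕ → Bool) {π m : ℕ} (h : m % 2 = π % 2) {j : ℕ} (hj : j < m) :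
    (e m = true → coord e π j < coord e π m) ∧ (e m = false → coord e π m < coord e π j) := by
  have hb : block π m = m := by simp [block, h]
  have : mag π j < mag π m := by simp only [mag]; split_ifs <;> omega
  simp only [coord, hb]
  constructor <;> intro he <;> simp only [he, if_true, Bool.false_eq_true, if_false] <;>
    split_ifs <;> omega

/-- Pin `m` is at distance `2 m - 1`, pin `m - 1` at `2 m` on the same side, and the earlier ones at
most at `2 m - 4`. -/
theorem separatesLast_coord (e : ℕ → Bool) {π m : ℕ} (h : m % 2 ≠ π % 2) (hm : 2 ≤ m) :
    SeparatesLast (coord e π) m := by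
  have hb : block π m = m - 1 := by simp [block, h]
  have hb' : block π (m - 1) = m - 1 := by simp only [block]; split_ifs <;> omega
  have h1 : mag π m < mag π (m - 1) := by simp only [mag]; split_ifs <;> omega
  have h2 : ∀ j < m - 1, mag π j < mag π m := by
    intro j hj; simp only [mag]; split_ifs <;> omega
  simp only [SeparatesLast, coord, hb, hb']
  rcases h : e (m - 1)
  · refine .inr ⟨by simp; omega, fun j hj => ?_⟩
    have := h2 j hj
    simp only [Bool.false_eq_true, if_false]
    split_ifs <;> omega
  · refine .inl ⟨by simp; omega, fun j hj => ?_⟩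
    have := h2 j hj
    simp only [if_true]
    split_ifs <;> omega

/-! ### Pin words in terms of signs -/

/-- The letter with the given orientation and direction. -/
def mkLetter : Bool → Bool → Letter
  | true, true => .u
  | true, false => .d
  | false, true => .r
  | false, false => .l

/-- The quadrant with the given signs of abscissa and ordinate. -/
def mkQuadrant : Bool → Bool → Quadrant
  | true, true => .one
  | false, true => .two
  | false, false => .three
  | true, false => .four

/-- Whether the axis `k` is vertical, if `v` tells whether the axis `0` is. -/
def axisVertical (v : Bool) (k : ℕ) : Bool := if k % 2 = 0 then v else !v

/-- The word of length `n` with the signs `e`, where `v` tells whether the axis `0` is vertical. -/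
def mkWord (v : Bool) (e : ℕ → Bool) (n : ℕ) : Word where
  numeral := if v then mkQuadrant (e 1) (e 0) else mkQuadrant (e 0) (e 1)
  -- The letter of index `i` places pin `i + 2`; the numeral settles pin `1`.
  letters := (List.range (n - 1)).map fun i => mkLetter (axisVertical v (i + 2)) (e (i + 2))

theorem mkLetter_inj {a b a' b' : Bool} : mkLetter a b = mkLetter a' b' ↔ a = a' ∧ b = b' := by
  decide +revert

@[simp] theorem isVertical_mkLetter (a b : Bool) : (mkLetter a b).isVertical = a := by
  decide +revert

theorem exists_mkLetter (c : Letter) : ∃ b, c = mkLetter c.isVertical b := by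
  cases c <;> simp [mkLetter, Letter.isVertical]

theorem length_mkWord (v : Bool) (e : ℕ → Bool) {n : ℕ} (hn : 1 ≤ n) :
    (mkWord v e n).length = n := by
  simp [mkWord, Word.length]; omega

theorem axisVertical_succ (v : Bool) (k : ℕ) : axisVertical v (k + 1) = !axisVertical v k := by
  simp only [axisVertical]
  split_ifs <;> first | omega | simp

theorem isPinWord_mkWord (v : Bool) (e : ℕ → Bool) (n : ℕ) : (mkWord v e n).IsPinWord := by
  rw [Word.IsPinWord, List.isChain_iff_getElem]
  intro i hi
  simp [mkWord, axisVertical_succ _ (i + 2), show i + 1 + 2 = i + 2 + 1 by ring]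

theorem mkWord_inj {v v' : Bool} {e e' : ℕ → Bool} {n : ℕ} (hn : 2 ≤ n) :
    mkWord v e n = mkWord v' e' n ↔ v = v' ∧ ∀ k ≤ n, e k = e' k := by
  simp only [mkWord, Word.mk.injEq]
  rw [List.map_inj_left]
  simp only [List.mem_range, mkLetter_inj]
  constructor
  · rintro ⟨h1, h2⟩
    have hv : v = v' := by simpa [axisVertical] using (h2 0 (by omega)).1
    subst hv
    have h01 : e 0 = e' 0 ∧ e 1 = e' 1 := by
      revert h1
      cases v <;> cases e 0 <;> cases e 1 <;> cases e' 0 <;> cases e' 1 <;> simp [mkQuadrant]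
    refine ⟨rfl, fun k hk => ?_⟩
    match k with
    | 0 => exact h01.1
    | 1 => exact h01.2
    | k + 2 => exact (h2 k (by omega)).2
  · rintro ⟨rfl, h⟩
    refine ⟨by rw [h 0 (by omega), h 1 (by omega)], fun k hk => ⟨rfl, h _ (by omega)⟩⟩

theorem Word.IsPinWord.exists_eq_mkWord {w : Word} (hw : w.IsPinWord) :
    ∃ v e, w = mkWord v e w.length := by
  obtain ⟨q, t⟩ := w
  rw [Word.IsPinWord, List.isChain_iff_getElem] at hw
  dsimp only at hw
  let v := (t.getD 0 .u).isVertical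
  obtain ⟨a, b, hq⟩ : ∃ a b, q = if v then mkQuadrant b a else mkQuadrant a b := by
    generalize v = v'
    cases q <;> cases v' <;> decide
  have hv : ∀ i (hi : i < t.length), (t[i]).isVertical = axisVertical v (i + 2) := by
    intro i
    induction i with
    | zero => intro hi; simp [v, axisVertical, List.getD_eq_getElem?_getD, hi]
    | succ i ih =>
      intro hi
      have h1 := hw i hi
      rw [ih (by omega)] at h1
      rw [show i + 1 + 2 = i + 2 + 1 by ring, axisVertical_succ]
      exact Bool.eq_not.2 h1.symm
  choose s hs using exists_mkLetter
  refine ⟨v, fun k => if k = 0 then a else if k = 1 then b else s (t.getD (k - 2) .u), ?_⟩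
  simp only [mkWord, Word.mk.injEq, Word.length]
  refine ⟨by simpa using hq, ?_⟩
  refine List.ext_getElem (by simp) fun i hi _ => ?_
  simp only [List.getElem_map, List.getElem_range, Nat.add_one_sub_one]
  rw [← hv i hi]
  simpa [List.getD_eq_getElem?_getD, hi] using hs t[i]

/-- The name of the horizontal axis. -/
def axisX (v : Bool) : ℕ := if v then 1 else 0

/-- The name of the vertical axis. -/
def axisY (v : Bool) : ℕ := if v then 0 else 1

/-- The coordinates `X` are left general because this is applied both to `coord` and to the
relabelled pins of another sequence. -/
theorem isPinDrawing_mkWord (v : Bool) {e : ℕ → Bool} {n : ℕ} {X : ℕ → ℕ → ℤ}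
    (hX : ∀ π π', π % 2 = π' % 2 → X π = X π')
    (hfirst : ∀ π ≤ 1, (e π = true → X π 0 < X π 1) ∧ (e π = false → X π 1 < X π 0))
    (hlast : ∀ m, 2 ≤ m → m ≤ n → ∀ j < m,
      (e m = true → X m j < X m m) ∧ (e m = false → X m m < X m j))
    (hsep : ∀ m, 2 ≤ m → m ≤ n → SeparatesLast (X (m + 1)) m) :
    IsPinDrawing (mkWord v e n) (X (axisX v)) (X (axisY v)) where
  first := by
    have h0 := hfirst 0 (by omega)
    have h1 := hfirst 1 (by omega)
    cases v <;> rcases he0 : e 0 <;> rcases he1 : e 1 <;>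
      simp_all [mkWord, mkQuadrant, axisX, axisY]
  next k hk := by
    have hl : (mkWord v e n).letters[k] = mkLetter (axisVertical v (k + 2)) (e (k + 2)) := by
      simp [mkWord]
    have hkn : k + 2 ≤ n := by simp [mkWord] at hk; omega
    have key : ∀ π, (k + 2) % 2 = π % 2 → ∀ j < k + 2,
        (e (k + 2) = true → X π j < X π (k + 2)) ∧ (e (k + 2) = false → X π (k + 2) < X π j) :=
      fun π h j hj => hX _ π h ▸ hlast (k + 2) (by omega) hkn j hj
    have key' : ∀ π, (k + 2 + 1) % 2 = π % 2 → SeparatesLast (X π) (k + 2) :=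
      fun π h => hX _ π h ▸ hsep (k + 2) (by omega) hkn
    rw [hl]
    rcases Nat.mod_two_eq_zero_or_one k with h | h <;> cases v <;> rcases he : e (k + 2) <;>
      simp only [axisVertical, Nat.add_mod_right, h, if_true, mkLetter, axisX, axisY,
        Bool.false_eq_true, if_false, Bool.not_true, Bool.not_false, one_ne_zero] <;>
      refine ⟨fun j hj => ?_, key' _ (by omega)⟩ <;>
      first
        | exact (key _ (by omega) j hj).1 he
        | exact (key _ (by omega) j hj).2 he

theorem isPinDrawing_mkWord_coord (v : Bool) (e : ℕ → Bool) (n : ℕ) :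
    IsPinDrawing (mkWord v e n) (coord e (axisX v)) (coord e (axisY v)) :=
  isPinDrawing_mkWord v (fun _ _ h => coord_congr e h)
    (fun π hπ => by interval_cases π <;> rcases h : e 0 <;> rcases h' : e 1 <;>
      simp [coord, block, mag, h, h'])
    (fun m _ _ _ hj => coord_last e rfl hj)
    (fun m hm _ => separatesLast_coord e (by omega) hm)

theorem isModel_pinPerm_mkWord (v : Bool) (e : ℕ → Bool) {n : ℕ} (hn : 1 ≤ n) :
    (mkWord v e n).pinPerm.IsModel (fun i : Fin (n + 1) => coord e (axisX v) i)
      (fun i => coord e (axisY v) i) 0 := by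
  have hl := length_mkWord v e hn
  have hlt := fun i j => (pinPoint_isPinDrawing _ (isPinWord_mkWord v e n)).lt_iff
    (isPinDrawing_mkWord_coord v e n) i j
  have inj : ∀ π, Function.Injective fun i : Fin ((mkWord v e n).length + 1) => coord e π i :=
    fun π => (coord_injective e π).comp Fin.val_injective
  have hinj : ∀ (x : ℕ → ℤ) π, (∀ i j, i ≤ (mkWord v e n).length → j ≤ (mkWord v e n).length →
      (x i < x j ↔ coord e π i < coord e π j)) →
      Function.Injective fun i : Fin ((mkWord v e n).length + 1) => x i := by
    intro x π hx i j hij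
    have h1 := hx i j (by omega) (by omega)
    have h2 := hx j i (by omega) (by omega)
    have hij' : x i = x j := hij
    apply inj π
    dsimp only
    omega
  refine (CentredPerm.isModel_ofPoints (hinj _ _ fun i j hi hj => (hlt i j hi hj).1)
    (hinj _ _ fun i j hi hj => (hlt i j hi hj).2)).comp (finCongr (by omega)) ?_ ?_ ?_
  · exact fun i j => ((hlt i j (by omega) (by omega)).1).symm
  · exact fun i j => ((hlt i j (by omega) (by omega)).2).symm
  · ext; simp

/-! ### Box decompositions -/

theorem exists_outer_of_between {e : ℕ → Bool} {π s t u : ℕ} (hu : u ≠ 0)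
    (h1 : coord e π s < coord e π u) (h2 : coord e π u < coord e π t) :
    Outer e π s u ∨ Outer e π t u := by
  have h0 : coord e π u ≠ 0 := fun h => hu (coord_injective e π (by simpa using h))
  simp only [outer_iff_coord]
  omega

/-- Pin `k + 1` separates pin `k` from its predecessors, hence lies just inside it along the axis on
which pin `k` was placed. -/
theorem outer_succ (e : ℕ → Bool) {k : ℕ} (hk : k ≠ 0) : Outer e k k (k + 1) := by
  have hb : block k (k + 1) = k := by simp only [block]; split_ifs <;> omega
  refine ⟨by omega, by rw [hb]; simp [block], ?_⟩
  simp only [mag]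
  split_ifs <;> omega

/-- An interval containing the origin contains every pin that one of its members is beyond. By
`outer_succ` it then contains pin `k + 1` along with pin `k ≥ 1`, so it is a final segment plus the
origin; `j ≥ 2` because it is proper. -/
theorem isBoxDecomposable_mkWord_iff (v : Bool) (e : ℕ → Bool) {n : ℕ} (hn : 2 ≤ n) :
    (mkWord v e n).pinPerm.IsBoxDecomposable ↔ ∃ j, 2 ≤ j ∧ j ≤ n ∧
      ∀ s u π, j ≤ s → s ≤ n → 1 ≤ u → u < j → ¬ Outer e π s u := by
  have inj : ∀ π, Function.Injective fun i : Fin (n + 1) => coord e π i :=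
    fun π => (coord_injective e π).comp Fin.val_injective
  rw [(isModel_pinPerm_mkWord v e (by omega)).isBoxDecomposable_iff (inj _) (inj _)]
  constructor
  · rintro ⟨S, h0, hS, ⟨u₀, hu₀⟩, hx, hy⟩
    have closed : ∀ (s u : Fin (n + 1)) π, s ∈ S → (u : ℕ) ≠ 0 → Outer e π s u → u ∈ S := by
      intro s u π hs hu0 hsu
      by_contra hu
      have hc : IsIntervalOn S fun i : Fin (n + 1) => coord e π i := by
        have : π % 2 = axisX v % 2 ∨ π % 2 = axisY v % 2 := by
          cases v <;> simp only [axisX, axisY] <;> simp <;> omega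
        rcases this with h | h <;> rw [coord_congr e h] <;> assumption
      rw [outer_iff_coord] at hsu
      have h1 := hc 0 h0 s hs u hu
      have h2 := hc s hs 0 h0 u hu
      simp only [Fin.val_zero, coord_zero] at h1 h2
      tauto
    have up : ∀ k l (hk : k < n + 1) (hl : l < n + 1), k ≠ 0 → k ≤ l →
        (⟨k, hk⟩ : Fin (n + 1)) ∈ S → (⟨l, hl⟩ : Fin (n + 1)) ∈ S := by
      intro k l hk hl hk0 hkl hkS
      induction l, hkl using Nat.le_induction with
      | base => exact hkS
      | succ l hkl ih =>
        exact closed ⟨l, by omega⟩ _ l (ih (by omega)) (by simp) (outer_succ e (by omega))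
    obtain ⟨s₀, hs₀, hs₀'⟩ := hS.exists_ne 0
    have hex : ∃ j, j ≠ 0 ∧ ∃ h : j < n + 1, (⟨j, h⟩ : Fin (n + 1)) ∈ S :=
      ⟨s₀, fun h => hs₀' (Fin.ext h), s₀.2, hs₀⟩
    classical
    obtain ⟨hj0, hjn, hjS⟩ := Nat.find_spec hex
    have hmin := fun m (hm : m < Nat.find hex) => Nat.find_min hex hm
    generalize Nat.find hex = j at *
    refine ⟨j, ?_, by omega, fun s u π hs hsn hu huj hsu => ?_⟩
    · by_contra hj2
      have hu₀0 : (u₀ : ℕ) ≠ 0 := fun h => hu₀ ((Fin.ext h : u₀ = 0) ▸ h0)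
      exact hu₀ (up j u₀ hjn u₀.2 hj0 (by omega) hjS)
    · exact hmin u huj ⟨by omega, by omega, closed ⟨s, by omega⟩ ⟨u, by omega⟩ π
        (up j s hjn (by omega) hj0 hs hjS) (by simp; omega) hsu⟩
  · rintro ⟨j, hj, hjn, h⟩
    have hc : ∀ π, IsIntervalOn {i : Fin (n + 1) | i = 0 ∨ j ≤ i} fun i => coord e π i := by
      rintro π s hs t ht u hu ⟨h1, h2⟩
      simp only [Set.mem_ofPred_eq, not_or, not_le] at hs ht hu
      have hu0 : (u : ℕ) ≠ 0 := fun h => hu.1 (Fin.ext h)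
      have aux : ∀ s : Fin (n + 1), (s = 0 ∨ j ≤ s) → ¬ Outer e π s u := by
        rintro s (rfl | hs)
        · simp [Outer]
        · exact h s u π hs (by omega) (by omega) hu.2
      exact (exists_outer_of_between hu0 h1 h2).elim (aux s hs) (aux t ht)
    refine ⟨{i | i = 0 ∨ j ≤ i}, .inl rfl, ⟨0, .inl rfl, Fin.last n, .inr hjn, ?_⟩,
      ⟨⟨1, by omega⟩, ?_⟩, hc _, hc _⟩
    · intro h; have := congrArg Fin.val h; simp at this; omega
    · simp only [Set.mem_compl_iff, Set.mem_ofPred_eq, not_or, not_le]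
      exact ⟨fun h => by have := congrArg Fin.val h; simp at this, hj⟩

/-- The signs `a`, `b` alternate, except that they are negated for the indices from `lo` to
`hi - 1`. -/
def signs (a b : Bool) (lo hi k : ℕ) : Bool :=
  (if k % 2 = 0 then a else b) ^^ decide (lo ≤ k ∧ k < hi)

theorem signs_of_mem {a b : Bool} {lo hi k : ℕ} (h : lo ≤ k) (h' : k < hi) :
    signs a b lo hi k = !(if k % 2 = 0 then a else b) := by
  simp [signs, h, h']

theorem signs_of_notMem {a b : Bool} {lo hi k : ℕ} (h : k < lo ∨ hi ≤ k) :
    signs a b lo hi k = if k % 2 = 0 then a else b := by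
  have : ¬ (lo ≤ k ∧ k < hi) := by omega
  simp [signs, this]

/-- Pin `j` is farther out than the earlier pairs on both axes, so `e j` and `e (j - 1)` must differ
from all earlier signs of their parity, which are therefore constant. -/
theorem not_outer_iff_spiral (e : ℕ → Bool) {n j : ℕ} (hj : 2 ≤ j) (hjn : j ≤ n) :
    (∀ s u π, j ≤ s → s ≤ n → 1 ≤ u → u < j → ¬ Outer e π s u) ↔
      (j = 2 ∧ ∀ k, 2 ≤ k → k ≤ n → e k ≠ e (k % 2)) ∨
      (3 ≤ j ∧ j = n ∧ (∀ k, k + 2 ≤ n → e k = e (k % 2)) ∧ e (n - 1) ≠ e ((n - 1) % 2) ∧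
        e n ≠ e (n % 2)) := by
  constructor
  · intro h
    have key : ∀ s u π, j ≤ s → s ≤ n → 1 ≤ u → u < j → mag π u < mag π s →
        e (block π s) ≠ e (block π u) :=
      fun s u π hs hsn hu huj hm he => h s u π hs hsn hu huj ⟨by omega, he, hm⟩
    rcases hj.eq_or_lt with rfl | hj3
    · refine .inl ⟨rfl, fun k hk hkn => ?_⟩
      have := key k 1 k hk hkn le_rfl (by omega) (by simp only [mag]; split_ifs <;> omega)
      rcases Nat.mod_two_eq_zero_or_one k with h2 | h2 <;> simpa [block, h2] using this
    · refine .inr ⟨hj3, ?_⟩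
      have h1 : ∀ k < j, k % 2 = j % 2 → e k ≠ e j := by
        intro k hk hkj
        have := key j (k + 1) j le_rfl hjn (by omega) (by omega)
          (by simp only [mag]; split_ifs <;> omega)
        simpa [block, show (k + 1) % 2 ≠ j % 2 by omega] using this.symm
      have h2 : ∀ k < j - 1, k % 2 = (j - 1) % 2 → e k ≠ e (j - 1) := by
        intro k hk hkj
        have := key j (k + 1) (j - 1) le_rfl hjn (by omega) (by omega)
          (by simp only [mag]; split_ifs <;> omega)
        simpa [block, show (k + 1) % 2 ≠ (j - 1) % 2 by omega,
          show j % 2 ≠ (j - 1) % 2 by omega] using this.symm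
      -- Pins `j - 1` and `j - 2` are on opposite sides along the axis of pin `j + 1`, so a pin `j +
      -- 1` would be beyond one of them.
      obtain rfl : j = n := by
        by_contra hne
        have h3 := key (j + 1) (j - 1) (j + 1) (by omega) (by omega) (by omega) (by omega)
          (by simp only [mag]; split_ifs <;> first | omega | contradiction)
        have h4 := key (j + 1) (j - 2) (j + 1) (by omega) (by omega) (by omega) (by omega)
          (by simp only [mag]; split_ifs <;> first | omega | contradiction)
        have h5 := h2 (j - 3) (by omega) (by omega)
        simp only [block, if_true, show (j - 1) % 2 = (j + 1) % 2 by omega,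
          show (j - 2) % 2 ≠ (j + 1) % 2 by omega, if_false, show j - 2 - 1 = j - 3 by omega]
          at h3 h4
        revert h3 h4 h5
        cases e (j + 1) <;> cases e (j - 1) <;> cases e (j - 3) <;> simp
      have h3 : e (j - 1) ≠ e ((j - 1) % 2) := (h2 _ (by omega) (by omega)).symm
      have h4 : e j ≠ e (j % 2) := (h1 _ (by omega) (by omega)).symm
      refine ⟨rfl, fun k hk => ?_, h3, h4⟩
      rcases Nat.mod_two_eq_zero_or_one (j + k) with h | h
      · rw [Bool.eq_not.2 (h1 k (by omega) (by omega)),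
          Bool.eq_not.2 (h1 (k % 2) (by omega) (by omega))]
      · rw [Bool.eq_not.2 (h2 k (by omega) (by omega)),
          Bool.eq_not.2 (h2 (k % 2) (by omega) (by omega))]
  · rintro (⟨rfl, h⟩ | ⟨hj3, rfl, h, h', h''⟩) s u π hs hsn hu huj ⟨-, he, hm⟩
    · obtain rfl : u = 1 := by omega
      have hs' : 2 ≤ block π s ∧ block π s ≤ n ∧ block π s % 2 = block π 1 := by
        revert hm
        simp only [mag, block]; split_ifs <;> first | omega | contradiction
      exact h _ hs'.1 hs'.2.1 (by rw [hs'.2.2, he])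
    · obtain rfl : s = j := by omega
      have hu' : block π u + 2 ≤ s ∧ block π u % 2 = block π s % 2 ∧
          (block π s = s ∨ block π s = s - 1) := by
        revert hm
        simp only [mag, block]; split_ifs <;> omega
      rw [h _ hu'.1, hu'.2.1] at he
      rcases hu'.2.2 with h3 | h3 <;> rw [h3] at he
      · exact h'' he
      · exact h' he

theorem isBoxDecomposable_mkWord_iff_signs (v : Bool) (e : ℕ → Bool) {n : ℕ} (hn : 2 ≤ n) :
    (mkWord v e n).pinPerm.IsBoxDecomposable ↔
      ∃ a b, (3 ≤ n ∧ ∀ k ≤ n, e k = signs a b (n - 1) (n + 1) k) ∨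
        ∀ k ≤ n, e k = signs a b 2 (n + 1) k := by
  rw [isBoxDecomposable_mkWord_iff v e hn]
  constructor
  · rintro ⟨j, hj, hjn, h⟩
    refine ⟨e 0, e 1, ?_⟩
    have hpar : ∀ k, (if k % 2 = 0 then e 0 else e 1) = e (k % 2) := by
      intro k; rcases Nat.mod_two_eq_zero_or_one k with h | h <;> simp [h]
    rcases (not_outer_iff_spiral e hj hjn).1 h with ⟨rfl, h₁⟩ | ⟨hj3, rfl, h₁, h', h''⟩
    · right
      intro k hk
      by_cases h2 : 2 ≤ k
      · rw [signs_of_mem h2 (by omega), hpar, Bool.eq_not.2 (h₁ k h2 hk)]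
      · rw [signs_of_notMem (by omega), hpar, show k % 2 = k by omega]
    · left
      refine ⟨hj3, fun k hk => ?_⟩
      by_cases h2 : k + 2 ≤ j
      · rw [signs_of_notMem (by omega), hpar, h₁ k h2]
      · have : e k ≠ e (k % 2) := by
          obtain rfl | rfl : k = j - 1 ∨ k = j := by omega
          · exact h'
          · exact h''
        rw [signs_of_mem (by omega) (by omega), hpar, Bool.eq_not.2 this]
  · rintro ⟨a, b, ⟨hn3, h⟩ | h⟩
    · refine ⟨n, hn, le_rfl, (not_outer_iff_spiral e hn le_rfl).2 (.inr ⟨hn3, rfl, ?_, ?_, ?_⟩)⟩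
      · intro k hk
        rw [h k (by omega), h (k % 2) (by omega), signs_of_notMem (by omega),
          signs_of_notMem (by omega), Nat.mod_mod]
      · rw [h _ (by omega), h _ (by omega), signs_of_mem (by omega) (by omega),
          signs_of_notMem (by omega), Nat.mod_mod]
        exact Bool.not_ne_self _
      · rw [h _ (by omega), h _ (by omega), signs_of_mem (by omega) (by omega),
          signs_of_notMem (by omega), Nat.mod_mod]
        exact Bool.not_ne_self _
    · refine ⟨2, le_rfl, hn, (not_outer_iff_spiral e le_rfl hn).2 (.inl ⟨rfl, fun k hk hkn => ?_⟩)⟩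
      rw [h k hkn, h _ (by omega), signs_of_mem (by omega) (by omega),
        signs_of_notMem (by omega), Nat.mod_mod]
      exact Bool.not_ne_self _

/-! ### Pin sequences through the same points -/

/-- The pins with the signs `f` have the same relative order as those with the signs `e`, where the
pin `m` of the former is the pin `ψ m` of the latter, and the axis `π` of the former is the axis
`π + d` of the latter. -/
structure PinMatch (n d : ℕ) (e f : ℕ → Bool) (ψ χ : ℕ → ℕ) : Prop where
  map_le : ∀ a ≤ n, ψ a ≤ n
  inv_le : ∀ a ≤ n, χ a ≤ n
  inv_map : ∀ a ≤ n, χ (ψ a) = a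
  map_inv : ∀ a ≤ n, ψ (χ a) = a
  map_zero : ψ 0 = 0
  order : ∀ π, ∀ a ≤ n, ∀ b ≤ n,
    coord f π a < coord f π b ↔ coord e (π + d) (ψ a) < coord e (π + d) (ψ b)

/-- Whether the axes have to be interchanged. -/
def axisShift (v v' : Bool) : ℕ := if v = v' then 0 else 1

theorem axisX_add_axisShift (v v' : Bool) : (axisX v' + axisShift v v') % 2 = axisX v % 2 := by
  decide +revert

theorem axisY_add_axisShift (v v' : Bool) : (axisY v' + axisShift v v') % 2 = axisY v % 2 := by
  decide +revert

theorem axis_cases (v : Bool) (π : ℕ) : π % 2 = axisX v % 2 ∨ π % 2 = axisY v % 2 := by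
  cases v <;> simp only [axisX, axisY] <;> simp <;> omega

theorem exists_pinMatch {v v' : Bool} {e f : ℕ → Bool} {n : ℕ} (hn : 1 ≤ n)
    (h : (mkWord v e n).pinPerm = (mkWord v' f n).pinPerm) :
    ∃ ψ χ, PinMatch n (axisShift v v') e f ψ χ := by
  obtain ⟨φ, φ0, φx, φy⟩ :=
    (isModel_pinPerm_mkWord v' f hn).exists_equiv (h ▸ isModel_pinPerm_mkWord v e hn)
  have hval : ∀ a ≤ n, ((Fin.ofNat (n + 1) a : Fin (n + 1)) : ℕ) = a := fun a ha => by
    simp [Fin.ofNat, Nat.mod_eq_of_lt (Nat.lt_succ_of_le ha)]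
  refine ⟨fun a => φ (Fin.ofNat (n + 1) a), fun a => φ.symm (Fin.ofNat (n + 1) a),
    fun a _ => by omega, fun a _ => by omega, fun a ha => ?_, fun a ha => ?_, ?_,
    fun π a ha b hb => ?_⟩
  · simpa using hval a ha
  · simpa using hval a ha
  · simpa using congrArg Fin.val φ0
  · rcases axis_cases v' π with h | h
    · have := axisX_add_axisShift v v'
      rw [coord_congr f h, coord_congr e (show _ = axisX v % 2 by omega)]
      simpa only [hval a ha, hval b hb] using φx (Fin.ofNat (n + 1) a) (Fin.ofNat (n + 1) b)
    · have := axisY_add_axisShift v v'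
      rw [coord_congr f h, coord_congr e (show _ = axisY v % 2 by omega)]
      simpa only [hval a ha, hval b hb] using φy (Fin.ofNat (n + 1) a) (Fin.ofNat (n + 1) b)

theorem PinMatch.pinPerm_eq {v v' : Bool} {e f : ℕ → Bool} {n : ℕ} (hn : 1 ≤ n) {ψ χ : ℕ → ℕ}
    (h : PinMatch n (axisShift v v') e f ψ χ) :
    (mkWord v e n).pinPerm = (mkWord v' f n).pinPerm := by
  let φ : Fin (n + 1) ≃ Fin (n + 1) :=
    { toFun := fun a => ⟨ψ a, by have := h.map_le a (by omega); omega⟩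
      invFun := fun a => ⟨χ a, by have := h.inv_le a (by omega); omega⟩
      left_inv := fun a => Fin.ext (h.inv_map a (by omega))
      right_inv := fun a => Fin.ext (h.map_inv a (by omega)) }
  refine ((isModel_pinPerm_mkWord v e hn).comp φ (fun i j => ?_) (fun i j => ?_) ?_).unique
    (isModel_pinPerm_mkWord v' f hn)
  · rw [h.order _ _ (by omega) _ (by omega), coord_congr e (axisX_add_axisShift v v')]; rfl
  · rw [h.order _ _ (by omega) _ (by omega), coord_congr e (axisY_add_axisShift v v')]; rfl
  · exact Fin.ext h.map_zero

/-! ### Composition of matches and transport of `Outer` -/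

namespace PinMatch

variable {n d : ℕ} {e f : ℕ → Bool} {ψ χ : ℕ → ℕ}

theorem symm (h : PinMatch n d e f ψ χ) : PinMatch n d f e χ ψ where
  map_le := h.inv_le
  inv_le := h.map_le
  inv_map := h.map_inv
  map_inv := h.inv_map
  map_zero := by simpa [h.map_zero] using h.inv_map 0 (by omega)
  order π a ha b hb := by
    rw [h.order _ _ (h.inv_le a ha) _ (h.inv_le b hb), h.map_inv a ha, h.map_inv b hb,
      coord_congr e (show π % 2 = (π + d + d) % 2 by omega)]

theorem trans {d' : ℕ} {g : ℕ → Bool} {ψ' χ' : ℕ → ℕ} (h : PinMatch n d e f ψ χ)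
    (h' : PinMatch n d' f g ψ' χ') : PinMatch n (d + d') e g (ψ ∘ ψ') (χ' ∘ χ) where
  map_le a ha := h.map_le _ (h'.map_le a ha)
  inv_le a ha := h'.inv_le _ (h.inv_le a ha)
  inv_map a ha := by simp [h.inv_map _ (h'.map_le a ha), h'.inv_map a ha]
  map_inv a ha := by simp [h'.map_inv _ (h.inv_le a ha), h.map_inv a ha]
  map_zero := by simp [h.map_zero, h'.map_zero]
  order π a ha b hb := by
    rw [h'.order π a ha b hb, h.order _ _ (h'.map_le a ha) _ (h'.map_le b hb), add_assoc,
      add_comm d' d]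
    rfl

theorem map_inj (h : PinMatch n d e f ψ χ) {a b : ℕ} (ha : a ≤ n) (hb : b ≤ n)
    (hab : ψ a = ψ b) : a = b := by
  rw [← h.inv_map a ha, ← h.inv_map b hb, hab]

theorem inv_ne (h : PinMatch n d e f ψ χ) {a b : ℕ} (hb : b ≤ n) (hab : b ≠ ψ a) : χ b ≠ a :=
  fun e => hab (by rw [← e, h.map_inv b hb])

theorem sign (h : PinMatch n d e f ψ χ) (π : ℕ) {a : ℕ} (ha : a ≠ 0) (han : a ≤ n) :
    f (block π a) = e (block (π + d) (ψ a)) := by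
  have h0 : ψ a ≠ 0 := fun h0 => ha (h.map_inj han (by omega) (h0.trans h.map_zero.symm))
  have := h.order π 0 (by omega) a han
  rw [h.map_zero, coord_zero, coord_zero, coord_pos_iff _ _ ha, coord_pos_iff _ _ h0] at this
  exact Bool.eq_iff_iff.2 this

theorem outer (h : PinMatch n d e f ψ χ) (π : ℕ) {a b : ℕ} (ha : a ≤ n) (hb : b ≤ n) :
    Outer f π a b ↔ Outer e (π + d) (ψ a) (ψ b) := by
  have h1 := h.order π 0 (by omega) b hb
  have h2 := h.order π b hb 0 (by omega)
  rw [h.map_zero, coord_zero, coord_zero] at h1 h2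
  rw [outer_iff_coord, outer_iff_coord, h1, h2, h.order π a ha b hb, h.order π b hb a ha]

end PinMatch

/-! ### Possible images of the last pin under a match -/

theorem not_outer_last (e : ℕ → Bool) {a m : ℕ} (ham : a < m) : ¬ Outer e m a m := by
  rintro ⟨-, -, h⟩
  revert h
  simp only [mag]
  split_ifs <;> omega

/-- Together with `not_outer_last` this expresses the placement of pin `m` through `Outer` alone, so
that it can be carried through a match. -/
theorem outer_separated_iff (e : ℕ → Bool) {a m : ℕ} (hm : 2 ≤ m) (ham : a < m) :
    Outer e (m + 1) a m ↔ a = m - 1 := by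
  constructor
  · rintro ⟨-, -, h⟩
    revert h
    simp only [mag]
    split_ifs <;> omega
  · rintro rfl
    obtain ⟨k, rfl⟩ : ∃ k, m = k + 1 := ⟨m - 1, by omega⟩
    exact (Outer.congr_axis (by omega)).1 (outer_succ e (k := k) (by omega))

namespace PinMatch

variable {n d : ℕ} {e f : ℕ → Bool} {ψ χ : ℕ → ℕ}

theorem not_outer (h : PinMatch n d e f ψ χ) {m b : ℕ} (hm : m ≤ n) (hb : b ≤ n)
    (hbm : χ b < m) : ¬ Outer e (m + d) b (ψ m) := by
  have := not_outer_last f hbm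
  rwa [h.outer m (h.inv_le b hb) hm, h.map_inv b hb] at this

theorem outer_iff (h : PinMatch n d e f ψ χ) {m b : ℕ} (hm2 : 2 ≤ m) (hm : m ≤ n) (hb : b ≤ n)
    (hbm : χ b < m) : Outer e (m + 1 + d) b (ψ m) ↔ b = ψ (m - 1) := by
  have := outer_separated_iff f hm2 hbm
  rw [h.outer _ (h.inv_le b hb) hm, h.map_inv b hb] at this
  rw [this]
  exact ⟨fun e => by rw [← e, h.map_inv b hb], fun e => by rw [e, h.inv_map _ (by omega)]⟩

/-- Going backwards, the predecessor of a pin is recognised as the only remaining pin beyond it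
along the other axis, so the match is the identity; the sides of the pins then give the signs. -/
theorem eq_of_map_last (h : PinMatch n d e f ψ χ) (hn : 2 ≤ n) (hψ : ψ n = n) :
    d % 2 = 0 ∧ ∀ k ≤ n, e k = f k := by
  -- With the axes interchanged, pin `n - 1` would be beyond pin `n` along the axis where nothing
  -- may be.
  have hd : d % 2 = 0 := by
    by_contra hd
    have hb : χ (n - 1) < n := by
      have := h.inv_ne (a := n) (b := n - 1) (by omega) (by omega)
      have := h.inv_le (n - 1) (by omega)
      omega
    have h1 := h.not_outer le_rfl (by omega) hb
    rw [hψ, Outer.congr_axis (show (n + d) % 2 = (n + 1) % 2 by omega)] at h1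
    exact h1 ((outer_separated_iff e hn (by omega)).2 rfl)
  have hfix : ∀ m ≤ n, ∀ k, n - m ≤ k → k ≤ n → ψ k = k := by
    intro m
    induction m with
    | zero =>
      intro _ k hk hkn
      obtain rfl : k = n := by omega
      exact hψ
    | succ m ih =>
      intro hm k hk hkn
      by_cases hkm : n - m ≤ k
      · exact ih (by omega) k hkm hkn
      have hkm' : k + 1 = n - m := by omega
      rcases Nat.eq_zero_or_pos k with rfl | hk0
      · exact h.map_zero
      have h1 : ψ (k + 1) = k + 1 := ih (by omega) _ (by omega) (by omega)
      have hb : χ k < k + 1 := by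
        by_contra hc
        have h2 := h.map_inv k hkn
        rw [ih (by omega) (χ k) (by omega) (h.inv_le k hkn)] at h2
        omega
      have h2 := (h.outer_iff (by omega) (by omega) hkn hb).1 (by
        rw [h1, Outer.congr_axis (show _ = (k + 1 + 1) % 2 by omega)]
        exact (outer_separated_iff e (by omega) (by omega)).2 rfl)
      simpa using h2.symm
  refine ⟨hd, fun k hk => ?_⟩
  rcases Nat.eq_zero_or_pos k with rfl | hk0
  · have := h.sign 0 (a := 1) (by omega) (by omega)
    rw [hfix n le_rfl 1 (by omega) (by omega), block_congr (show (0 + d) % 2 = 0 % 2 by omega)]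
      at this
    exact this.symm
  · have := h.sign k (a := k) (by omega) hk
    rw [hfix n le_rfl k (by omega) hk, block_congr (show (k + d) % 2 = k % 2 by omega)] at this
    simpa [block] using this.symm

theorem inv_lt_of_ne (h : PinMatch n d e f ψ χ) {b : ℕ} (hb : b ≤ n) (hb' : b ≠ ψ n) :
    χ b < n :=
  lt_of_le_of_ne (h.inv_le b hb) (h.inv_ne hb hb')

theorem inv_lt_of_ne₂ (h : PinMatch n d e f ψ χ) {b : ℕ} (hb : b ≤ n) (hb' : b ≠ ψ n)
    (hb'' : b ≠ ψ (n - 1)) : χ b < n - 1 := by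
  have := h.inv_lt_of_ne hb hb'
  have := h.inv_ne hb hb''
  omega

/-- If the last pin of the second sequence is the pin `1` of the first one. -/
theorem signs_of_map_last_eq_one (h : PinMatch n d e f ψ χ) (hn : 2 ≤ n) (hψ : ψ n = 1) :
    (∀ k, 2 ≤ k → k < n → e k ≠ e (k % 2)) ∧ e n = e (n % 2) := by
  have hlt : ∀ b, 2 ≤ b → b ≤ n → χ b < n := fun b hb hbn => h.inv_lt_of_ne hbn (by omega)
  have hc1 : ψ (n - 1) ≤ n := h.map_le _ (by omega)
  have hc0 : ψ (n - 1) ≠ 0 := fun h0 => by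
    have := h.map_inj (a := n - 1) (b := 0) (by omega) (by omega) (h0.trans h.map_zero.symm)
    omega
  have hc2 : ψ (n - 1) ≠ 1 := fun h0 => by
    have := h.map_inj (a := n - 1) (b := n) (by omega) (by omega) (h0.trans hψ.symm)
    omega
  have hc := (h.outer_iff hn le_rfl hc1 (hlt _ (by omega) hc1)).2 rfl
  have hout : ∀ k l, 2 ≤ k → (l = k ∨ l = k + 1) → e k = e (k % 2) → Outer e k l 1 := by
    intro k l hk hl he
    have h1 : block k l = k := by simp only [block]; split_ifs <;> omega
    have h2 : block k 1 = k % 2 := by simp only [block]; split_ifs <;> omega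
    refine ⟨by omega, by rw [h1, h2, he], ?_⟩
    simp only [mag]; split_ifs <;> omega
  have hown : ∀ k, 2 ≤ k → k ≤ n → k % 2 = (n + d) % 2 → e k ≠ e (k % 2) := by
    intro k hk hkn hp he
    have := h.not_outer le_rfl hkn (hlt k hk hkn)
    rw [hψ, Outer.congr_axis hp.symm] at this
    exact this (hout k k hk (.inl rfl) he)
  -- Only one pin may be beyond pin `1` along this axis, but the pair `{k, k + 1}` would supply two.
  -- For `k = n` the pair is reduced to pin `n`, which is why `n` is excluded.
  have hother : ∀ k, 2 ≤ k → k < n → k % 2 = (n + 1 + d) % 2 → e k ≠ e (k % 2) := by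
    intro k hk hkn hp he
    have h1 := h.outer_iff hn le_rfl hkn.le (hlt k hk hkn.le)
    have h2 := h.outer_iff hn le_rfl hkn (hlt (k + 1) (by omega) hkn)
    rw [hψ, Outer.congr_axis hp.symm] at h1 h2
    have := h1.1 (hout k k hk (.inl rfl) he)
    have := h2.1 (hout k (k + 1) hk (.inr rfl) he)
    omega
  have hall : ∀ k, 2 ≤ k → k < n → e k ≠ e (k % 2) := by
    intro k hk hkn
    rcases Nat.mod_two_eq_zero_or_one (k + (n + d)) with hp | hp
    · exact hown k hk hkn.le (by omega)
    · exact hother k hk hkn (by omega)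
  refine ⟨hall, ?_⟩
  -- The predecessor `ψ (n - 1)` must be beyond pin `1`, and only the incomplete pair of pin `n` is
  -- left for it.
  obtain ⟨-, h1, h2⟩ := hc
  rw [hψ] at h1 h2
  generalize ψ (n - 1) = c at *
  have hb : 2 ≤ block (n + 1 + d) c ∧ block (n + 1 + d) c ≤ n ∧
      block (n + 1 + d) 1 = block (n + 1 + d) c % 2 := by
    revert h2
    simp only [mag, block]
    split_ifs <;> first | omega | contradiction
  rw [hb.2.2] at h1
  rcases hb.2.1.eq_or_lt with h3 | h3
  · rwa [h3] at h1
  · exact absurd h1 (hall _ hb.1 h3)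

/-- If the last pin of the second sequence is neither the first nor the last pin of the first
sequence. -/
theorem of_one_lt_map_last (h : PinMatch n d e f ψ χ) {J : ℕ} (hJ : ψ n = J) (hJ1 : 1 < J)
    (hJn : J ≠ n) : J < n ∧ (n + d) % 2 = J % 2 ∧ ψ (n - 1) = J - 1 ∧
      (∀ k, J < k → k ≤ n → k % 2 = J % 2 → e k ≠ e J) ∧
      (∀ k, J < k → k ≤ n → k % 2 ≠ J % 2 → e k ≠ e (J - 1)) := by
  have hle : ψ n ≤ n := h.map_le n le_rfl
  have hlt : ∀ b ≤ n, b ≠ J → χ b < n := fun b hbn hb => h.inv_lt_of_ne hbn (by omega)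
  -- Pin `J - 1` is beyond pin `J` along axis `J + 1`, so this cannot be the axis where pin `J` has
  -- to be outermost.
  have hpar : (n + d) % 2 = J % 2 := by
    by_contra hp
    have h1 := h.not_outer le_rfl (b := J - 1) (by omega) (hlt _ (by omega) (by omega))
    rw [hJ, Outer.congr_axis (show _ = (J + 1) % 2 by omega)] at h1
    exact h1 ((outer_separated_iff e hJ1 (by omega)).2 rfl)
  have hψ : ψ (n - 1) = J - 1 := by
    refine ((h.outer_iff (by omega) le_rfl (by omega)
      (hlt (J - 1) (by omega) (by omega))).1 ?_).symm
    rw [hJ, Outer.congr_axis (show _ = (J + 1) % 2 by omega)]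
    exact (outer_separated_iff e hJ1 (by omega)).2 rfl
  refine ⟨by omega, hpar, hψ, fun k hk hkn hp he => ?_, fun k hk hkn hp he => ?_⟩
  · refine h.not_outer le_rfl hkn (hlt k hkn (by omega)) ?_
    rw [hJ, Outer.congr_axis hpar]
    refine ⟨by omega, by simpa [block, hp] using he, ?_⟩
    simp only [mag]; split_ifs <;> omega
  · have h1 := (h.outer_iff (by omega) le_rfl hkn (hlt k hkn (by omega))).1 (by
      rw [hJ, Outer.congr_axis (show _ = (J - 1) % 2 by omega)]
      refine ⟨by omega, ?_, ?_⟩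
      · simpa [block, show k % 2 = (J - 1) % 2 by omega,
          show J % 2 ≠ (J - 1) % 2 by omega] using he
      · simp only [mag]; split_ifs <;> omega)
    omega

/-- The uniqueness of the predecessor, applied to the penultimate pin `ψ (n - 1) = J - 1`. -/
theorem eq_map_of_outer (h : PinMatch n d e f ψ χ) {J : ℕ} (hn : 3 ≤ n) (hJ : ψ n = J)
    (hJ1 : 1 < J) (hJn : J ≠ n) {b : ℕ} (hbn : b ≤ n) (hb : b ≠ J) (hb' : b ≠ J - 1)
    (ho : Outer e J b (J - 1)) : b = ψ (n - 2) := by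
  obtain ⟨-, hpar, hψ, -, -⟩ := h.of_one_lt_map_last hJ hJ1 hJn
  refine (h.outer_iff (m := n - 1) (by omega) (by omega) hbn
    (h.inv_lt_of_ne₂ hbn (by omega) (by omega))).1 ?_
  rwa [hψ, Outer.congr_axis (show _ = J % 2 by omega)]

/-- Pin `J - 2` is beyond pin `J - 1` along axis `J`. If there were a pin `J + 2`, then pin `J + 1`
or pin `J + 2` would be a second one, according to whether `e J` equals `e (J - 2)`. -/
theorem eq_of_two_lt_map_last (h : PinMatch n d e f ψ χ) {J : ℕ} (hJ : ψ n = J) (hJ2 : 2 < J)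
    (hJn : J ≠ n) : J + 1 = n := by
  obtain ⟨hlt, -, -, hown, -⟩ := h.of_one_lt_map_last hJ (by omega) hJn
  have huniq := fun b => h.eq_map_of_outer (b := b) (by omega) hJ (by omega) hJn
  have h1 : J - 2 = ψ (n - 2) := huniq (J - 2) (by omega) (by omega) (by omega) (by
    have := outer_succ e (k := J - 2) (by omega)
    rwa [show J - 2 + 1 = J - 1 by omega,
      Outer.congr_axis (show (J - 2) % 2 = J % 2 by omega)] at this)
  by_contra hJn'
  by_cases h2 : e J = e (J - 2)
  · have h3 := huniq (J + 1) (by omega) (by omega) (by omega) (by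
      refine ⟨by omega, ?_, ?_⟩
      · simpa [block, show (J + 1) % 2 ≠ J % 2 by omega, show (J - 1) % 2 ≠ J % 2 by omega,
          show J - 1 - 1 = J - 2 by omega] using h2
      · simp only [mag]; split_ifs <;> first | omega | contradiction)
    omega
  · have h3 := hown (J + 2) (by omega) (by omega) (by omega)
    have h4 : e (J + 2) = e (J - 2) := by
      rw [Bool.eq_not.2 h3, Bool.eq_not.2 h2, Bool.not_not]
    have h5 := huniq (J + 2) (by omega) (by omega) (by omega) (by
      refine ⟨by omega, ?_, ?_⟩
      · simpa [block, show (J - 1) % 2 ≠ J % 2 by omega,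
          show J - 1 - 1 = J - 2 by omega] using h4
      · simp only [mag]; split_ifs <;> first | omega | contradiction)
    omega

theorem eq_three_of_map_last_eq_two (h : PinMatch n d e f ψ χ) (hn : 3 ≤ n) (hJ : ψ n = 2)
    (h2 : e 2 = e 0) : 3 = ψ (n - 2) :=
  h.eq_map_of_outer hn hJ (by omega) (by omega) (by omega) (by omega) (by omega)
    ⟨by omega, by simpa [block] using h2, by simp [mag]⟩

/-- If `e 2 ≠ e 0`, both pins `4` and `5` are beyond pin `1`. Otherwise `ψ (n - 2) = 3`, and for `n
≥ 6` both pins `5` and `6` are beyond pin `3`. In either case only one such pin is allowed. -/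
theorem of_map_last_eq_two (h : PinMatch n d e f ψ χ) (hn : 5 ≤ n) (hJ : ψ n = 2) :
    n = 5 ∧ e 2 = e 0 ∧ e 3 ≠ e 1 ∧ e 4 ≠ e 0 ∧ e 5 ≠ e 1 := by
  obtain ⟨-, hpar, hψ, hown, hother⟩ := h.of_one_lt_map_last hJ (by omega) (by omega)
  have huniq := fun b => h.eq_map_of_outer (b := b) (by omega) hJ (by omega) (by omega)
  have h4 := hown 4 (by omega) (by omega) rfl
  have h3 := hother 3 (by omega) (by omega) (by omega)
  have h5 := hother 5 (by omega) (by omega) (by omega)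
  have h2 : e 2 = e 0 := by
    by_contra h2
    have h40 : e 4 = e 0 := by rw [Bool.eq_not.2 h4, Bool.eq_not.2 h2, Bool.not_not]
    have h8 := huniq 4 (by omega) (by omega) (by omega)
      ⟨by omega, by simpa [block] using h40, by simp [mag]⟩
    have h9 := huniq 5 (by omega) (by omega) (by omega)
      ⟨by omega, by simpa [block] using h40, by simp [mag]⟩
    omega
  refine ⟨?_, h2, h3, h2 ▸ h4, h5⟩
  by_contra hn5
  have h6 : 3 = ψ (n - 2) := h.eq_three_of_map_last_eq_two (by omega) hJ h2
  have h7 : ∀ b ≤ n, 3 < b → Outer e 1 b 3 → b = ψ (n - 3) := by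
    intro b hbn hb ho
    have h8 := h.inv_lt_of_ne₂ hbn (by omega) (by omega)
    have h9 := h.inv_ne (a := n - 2) hbn (by omega)
    refine (h.outer_iff (m := n - 2) (by omega) (by omega) hbn (by omega)).1 ?_
    rwa [← h6, Outer.congr_axis (show _ = 1 % 2 by omega)]
  have h35 : e 5 = e 3 := by rw [Bool.eq_not.2 h3, Bool.eq_not.2 h5]
  have h8 := h7 5 (by omega) (by omega) ⟨by omega, by simpa [block] using h35, by simp [mag]⟩
  have h9 := h7 6 (by omega) (by omega) ⟨by omega, by simpa [block] using h35, by simp [mag]⟩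
  omega

theorem of_map_four_eq_two (h : PinMatch 4 d e f ψ χ) (hJ : ψ 4 = 2) :
    e 2 ≠ e 0 ∧ e 3 ≠ e 1 ∧ e 4 = e 0 := by
  obtain ⟨-, hpar, hψ, hown, hother⟩ := h.of_one_lt_map_last hJ (by omega) (by omega)
  have h4 := hown 4 (by omega) (by omega) rfl
  have h3 := hother 3 (by omega) (by omega) (by omega)
  have h2 : e 2 ≠ e 0 := by
    intro h2
    have h6 : 3 = ψ 2 := h.eq_three_of_map_last_eq_two (by omega) hJ h2
    have h7 : χ 4 = 1 := by
      have := h.inv_le 4 le_rfl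
      have := h.inv_ne (a := 4) (b := 4) le_rfl (by omega)
      have := h.inv_ne (a := 3) (b := 4) le_rfl (by simp at hψ; omega)
      have := h.inv_ne (a := 2) (b := 4) le_rfl (by omega)
      have := h.inv_ne (a := 0) (b := 4) le_rfl (by rw [h.map_zero]; omega)
      omega
    -- The pins would be taken in the order `4, 3, 1, 2`, yet pin `4` is not beyond pin `3` along
    -- axis `1`.
    have h8 : ψ 1 = 4 := by rw [← h7, h.map_inv 4 le_rfl]
    have h9 := (outer_separated_iff f (a := 1) (m := 2) le_rfl (by omega)).2 rfl
    rw [h.outer _ (by omega) (by omega), h8, ← h6,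
      Outer.congr_axis (show _ = 1 % 2 by omega)] at h9
    have := h9.2.2
    simp [mag] at this
  exact ⟨h2, h3, by rw [Bool.eq_not.2 h4, Bool.eq_not.2 h2, Bool.not_not]⟩

/-- Otherwise `ψ n = χ n = n - 1`, so `ψ (n - 1) = n`; but the predecessor rule gives `ψ (n - 1) = n
- 2`. -/
theorem cases_of_map_last_ne (h : PinMatch n d e f ψ χ) (hn : 2 ≤ n) (hψ : ψ n ≠ n) :
    (ψ n = 1 ∨ χ n = 1) ∨ (n = 4 ∧ (ψ n = 2 ∨ χ n = 2)) ∨ (n = 5 ∧ (ψ n = 2 ∨ χ n = 2)) := by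
  have hne : ∀ {d : ℕ} {e f : ℕ → Bool} {ψ χ : ℕ → ℕ}, PinMatch n d e f ψ χ → ψ n ≠ 0 :=
    fun h h0 => by
      have := h.map_inj (a := n) (b := 0) le_rfl (by omega) (h0.trans h.map_zero.symm)
      omega
  have h0 := hne h
  have h0' := hne h.symm
  have hχ : χ n ≠ n := h.inv_ne le_rfl (Ne.symm hψ)
  have h1 := h.map_inv n le_rfl
  by_contra hc
  simp only [not_or, not_and] at hc
  obtain ⟨⟨h2, h3⟩, h4, h5⟩ := hc
  obtain ⟨h6, -, h7, -⟩ := h.of_one_lt_map_last rfl (by omega) hψ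
  obtain ⟨h6', -, h7', -⟩ := h.symm.of_one_lt_map_last rfl (by omega) hχ
  have hlast : ∀ {d : ℕ} {e f : ℕ → Bool} {ψ χ : ℕ → ℕ}, PinMatch n d e f ψ χ → 1 < ψ n →
      ψ n < n → (n = 4 → ψ n ≠ 2) → (n = 5 → ψ n ≠ 2) → ψ n = n - 1 := by
    intro d e f ψ χ h h1 h2 h4 h5
    by_cases h3 : ψ n = 2
    · by_cases hn5 : 5 ≤ n
      · have := (h.of_map_last_eq_two hn5 h3).1
        omega
      · omega
    · have := h.eq_of_two_lt_map_last rfl (by omega) (by omega)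
      omega
  have h8 := hlast h (by omega) h6 (fun e => (h4 e).1) (fun e => (h5 e).1)
  have h9 := hlast h.symm (by omega) h6' (fun e => (h4 e).2) (fun e => (h5 e).2)
  rw [h9] at h1
  omega

end PinMatch

/-! ### Pairs of pin words which generate the same centred permutation -/

/-- The pins with the signs `f` are placed in the order `2, 3, …, n, 1` of the pins with the signs
`e`, which turn around the origin once between the first and the last pin. -/
structure IsShift (n : ℕ) (e f : ℕ → Bool) : Prop where
  turn : ∀ k, 2 ≤ k → k < n → e k ≠ e (k % 2)
  last : e n = e (n % 2)
  shift : ∀ k < n, f k = e (k + 1)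
  shift_last : f n = e ((n + 1) % 2)

def shiftPin (n m : ℕ) : ℕ := if m = 0 then 0 else if m = n then 1 else m + 1

def unshiftPin (n m : ℕ) : ℕ := if m = 0 then 0 else if m = 1 then n else m - 1

/-- A drawing of a word determines the order of its points, so it suffices that the relabelled pins
form a drawing for the signs `f`. The choice of vertical axis is immaterial; `true` is used. -/
theorem pinMatch_of_drawing {n d : ℕ} {e f : ℕ → Bool} {ψ χ : ℕ → ℕ} (hn : 1 ≤ n)
    (map_le : ∀ a ≤ n, ψ a ≤ n) (inv_le : ∀ a ≤ n, χ a ≤ n) (inv_map : ∀ a ≤ n, χ (ψ a) = a)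
    (map_inv : ∀ a ≤ n, ψ (χ a) = a) (map_zero : ψ 0 = 0)
    (hfirst : ∀ π ≤ 1, (f π = true → 0 < coord e (π + d) (ψ 1)) ∧
      (f π = false → coord e (π + d) (ψ 1) < 0))
    (hlast : ∀ m, 2 ≤ m → m ≤ n → ∀ j < m,
      (f m = true → coord e (m + d) (ψ j) < coord e (m + d) (ψ m)) ∧
      (f m = false → coord e (m + d) (ψ m) < coord e (m + d) (ψ j)))
    (hsep : ∀ m, 2 ≤ m → m ≤ n → SeparatesLast (fun j => coord e (m + 1 + d) (ψ j)) m) :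
    PinMatch n d e f ψ χ where
  map_le := map_le
  inv_le := inv_le
  inv_map := inv_map
  map_inv := map_inv
  map_zero := map_zero
  order π a ha b hb := by
    have hX : ∀ π π' : ℕ, π % 2 = π' % 2 →
        (fun j => coord e (π + d) (ψ j)) = fun j => coord e (π' + d) (ψ j) := fun π π' h => by
      rw [coord_congr e (show (π + d) % 2 = (π' + d) % 2 by omega)]
    have hD : IsPinDrawing (mkWord true f n) (fun j => coord e (1 + d) (ψ j))
        fun j => coord e (0 + d) (ψ j) :=
      isPinDrawing_mkWord true (X := fun π j => coord e (π + d) (ψ j)) hX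
        (by simpa only [map_zero, coord_zero] using hfirst) hlast hsep
    have hl := length_mkWord true f hn
    have := (isPinDrawing_mkWord_coord true f n).lt_iff hD a b (by omega) (by omega)
    rcases Nat.mod_two_eq_zero_or_one π with h | h
    · rw [coord_congr f (show π % 2 = 0 % 2 from h),
        coord_congr e (show (π + d) % 2 = (0 + d) % 2 by omega)]
      exact this.2
    · rw [coord_congr f (show π % 2 = 1 % 2 from h),
        coord_congr e (show (π + d) % 2 = (1 + d) % 2 by omega)]
      exact this.1

theorem coord_sign_iff (e : ℕ → Bool) (π : ℕ) {k : ℕ} (hk : k ≠ 0) :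
    (e (block π k) = true → 0 < coord e π k) ∧ (e (block π k) = false → coord e π k < 0) := by
  have := mag_pos (π := π) hk
  constructor <;> intro h <;> simp only [coord, h, if_true, Bool.false_eq_true, if_false] <;> omega

/-- The other pins are at the origin, in the pair of pin `1` but inside it, or on the opposite side;
hence pin `1` may as well be placed last. -/
theorem coord_lt_coord_one {e : ℕ → Bool} {n : ℕ} (he : ∀ k, 2 ≤ k → k < n → e k ≠ e (k % 2))
    (π : ℕ) {j : ℕ} (hj : j ≠ 1) (hjn : block π j < n) :
    (e (π % 2) = true → coord e π j < coord e π 1) ∧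
      (e (π % 2) = false → coord e π 1 < coord e π j) := by
  have h1 : block π 1 = π % 2 := by simp only [block]; split_ifs <;> omega
  have hpos := coord_sign_iff e π one_ne_zero
  rw [h1] at hpos
  rcases Nat.eq_zero_or_pos j with rfl | hj0
  · simpa using hpos
  have hmod : block π j % 2 = π % 2 := by simp only [block]; split_ifs <;> omega
  rcases Nat.lt_or_ge (block π j) 2 with hb | hb
  · have hm : mag π j < mag π 1 := by
      revert hb
      simp only [mag, block]; split_ifs <;> first | omega | contradiction
    have hb' : block π j = π % 2 := by omega
    constructor <;> intro h <;>
      simp only [coord, h1, hb', h, if_true, Bool.false_eq_true, if_false] <;> omega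
  · have hne := he _ hb hjn
    rw [hmod] at hne
    have hpos' := coord_sign_iff e π (k := j) (by omega)
    constructor <;> intro h <;> rw [h] at hne hpos
    · exact (hpos'.2 (by simpa using hne)).trans (hpos.1 rfl)
    · exact (hpos.2 rfl).trans (hpos'.1 (by simpa using hne))

theorem IsShift.pinMatch {n : ℕ} {e f : ℕ → Bool} (h : IsShift n e f) (hn : 2 ≤ n) :
    PinMatch n 1 e f (shiftPin n) (unshiftPin n) := by
  have hs : ∀ m, m ≠ 0 → m < n → shiftPin n m = m + 1 := fun m hm hmn => by
    simp only [shiftPin]; split_ifs <;> omega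
  have hsn : shiftPin n n = 1 := by simp only [shiftPin]; split_ifs <;> omega
  have hle : ∀ j m, j ≤ m → m < n → shiftPin n j ≤ m + 1 := fun j m hj hmn => by
    simp only [shiftPin]; split_ifs <;> omega
  have hne : ∀ j < n, shiftPin n j ≠ 1 := fun j hj => by
    simp only [shiftPin]; split_ifs <;> omega
  refine pinMatch_of_drawing (by omega) ?_ ?_ ?_ ?_ rfl ?_ ?_ ?_
  · intro a ha; simp only [shiftPin]; split_ifs <;> omega
  · intro a ha; simp only [unshiftPin]; split_ifs <;> omega
  · intro a ha; simp only [shiftPin, unshiftPin]; split_ifs <;> first | omega | simp_all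
  · intro a ha; simp only [shiftPin, unshiftPin]; split_ifs <;> omega
  · intro π hπ
    have hb : block (π + 1) 2 = π + 1 := by simp only [block]; split_ifs <;> omega
    have := coord_sign_iff e (π + 1) (k := 2) (by omega)
    rw [hb] at this
    rwa [hs 1 (by omega) (by omega), h.shift π (by omega)]
  · intro m hm hmn j hj
    rcases hmn.lt_or_eq with hmn | rfl
    · rw [hs m (by omega) hmn, h.shift m hmn]
      refine coord_last e rfl ?_
      have := hle j (m - 1) (by omega) (by omega)
      omega
    · rw [hsn, h.shift_last]
      refine coord_lt_coord_one h.turn (m + 1) (hne j hj) ?_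
      have := hle j (m - 1) (by omega) (by omega)
      simp only [block]; split_ifs <;> omega
  · intro m hm hmn
    rcases hmn.lt_or_eq with hmn | rfl
    · have := separatesLast_coord e (π := m + 1 + 1) (m := m + 1) (by omega) (by omega)
      simp only [SeparatesLast, hs m (by omega) hmn, hs (m - 1) (by omega) (by omega),
        Nat.add_sub_cancel, Nat.sub_add_cancel (show 1 ≤ m by omega)] at this ⊢
      refine this.imp (And.imp_right fun H j hj => H _ ?_) (And.imp_right fun H j hj => H _ ?_)
      all_goals
        have := hle j (m - 2) (by omega) (by omega)
        omega
    · have h1 : ∀ j < m - 1, _ := fun j hj =>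
        coord_lt_coord_one h.turn (m + 1 + 1) (j := shiftPin m j) (hne j (by omega)) (by
          have := hle j (m - 2) (by omega) (by omega)
          simp only [block]; split_ifs <;> omega)
      -- Pin `m` of `e`, the predecessor of pin `1` in the new order, is brought beyond pin `1` by
      -- `h.last`.
      have h2 : (e (m % 2) = true → coord e (m + 1 + 1) 1 < coord e (m + 1 + 1) m) ∧
          (e (m % 2) = false → coord e (m + 1 + 1) m < coord e (m + 1 + 1) 1) := by
        have := coord_last e (π := m + 1 + 1) (m := m) (by omega) (j := 1) (by omega)
        rwa [h.last] at this
      simp only [SeparatesLast, hsn, hs (m - 1) (by omega) (by omega),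
        Nat.sub_add_cancel (show 1 ≤ m by omega)]
      rw [show (m + 1 + 1) % 2 = m % 2 by omega] at h1
      rcases he : e (m % 2) <;> rw [he] at h1 h2
      · exact .inr ⟨h2.2 rfl, fun j hj => (h1 j hj).2 rfl⟩
      · exact .inl ⟨h2.1 rfl, fun j hj => (h1 j hj).1 rfl⟩

/-- The pins with the signs `f` are placed in the order `4, 5, 3, 1, 2` of the pins with the signs
`e`. -/
structure IsTwist (e f : ℕ → Bool) : Prop where
  two : e 2 = e 0
  three : e 3 ≠ e 1
  four : e 4 ≠ e 0
  five : e 5 ≠ e 1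
  twist_zero : f 0 = e 3
  twist_one : f 1 = e 4
  twist_two : f 2 = e 5
  twist_three : f 3 = e 2
  twist_four : f 4 = e 1
  twist_five : f 5 = e 0

def twistPin : ℕ → ℕ
  | 1 => 4
  | 2 => 5
  | 3 => 3
  | 4 => 1
  | 5 => 2
  | _ => 0

theorem IsTwist.pinMatch {e f : ℕ → Bool} (h : IsTwist e f) :
    PinMatch 5 1 e f twistPin twistPin where
  map_le a ha := by interval_cases a <;> simp [twistPin]
  inv_le a ha := by interval_cases a <;> simp [twistPin]
  inv_map a ha := by interval_cases a <;> simp [twistPin]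
  map_inv a ha := by interval_cases a <;> simp [twistPin]
  map_zero := rfl
  order π a ha b hb := by
    obtain ⟨h2, h3, h4, h5, f0, f1, f2, f3, f4, f5⟩ := h
    rcases Nat.mod_two_eq_zero_or_one π with h | h
    · rw [coord_congr f (show π % 2 = 0 % 2 from h),
        coord_congr e (show (π + 1) % 2 = 1 % 2 by omega)]
      interval_cases a <;> interval_cases b <;>
        simp [coord, twistPin, block, mag, *] <;> grind
    · rw [coord_congr f (show π % 2 = 1 % 2 from h),
        coord_congr e (show (π + 1) % 2 = 0 % 2 by omega)]
      interval_cases a <;> interval_cases b <;>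
        simp [coord, twistPin, block, mag, *] <;> grind

/-! ### Matches as shifts and twists -/

namespace PinMatch

variable {n d : ℕ} {e f : ℕ → Bool} {ψ χ : ℕ → ℕ}

theorem isShift (h : PinMatch n d e f ψ χ) (hn : 2 ≤ n) (hψ : ψ n = 1) :
    d % 2 = 1 ∧ IsShift n e f := by
  obtain ⟨h1, h2⟩ := h.signs_of_map_last_eq_one hn hψ
  have hg : IsShift n e fun k => if k < n then e (k + 1) else e ((n + 1) % 2) :=
    ⟨h1, h2, fun k hk => by simp [hk], by simp⟩
  obtain ⟨h3, h4⟩ := ((hg.pinMatch hn).symm.trans h).eq_of_map_last hn (by simp [hψ, unshiftPin])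
  refine ⟨by omega, h1, h2, fun k hk => ?_, ?_⟩
  · simpa [hk] using (h4 k hk.le).symm
  · simpa using (h4 n le_rfl).symm

theorem isTwist (h : PinMatch 5 d e f ψ χ) (hψ : ψ 5 = 2) : d % 2 = 1 ∧ IsTwist e f := by
  obtain ⟨-, h2, h3, h4, h5⟩ := h.of_map_last_eq_two (by omega) hψ
  let g : ℕ → Bool := fun k => [e 3, e 4, e 5, e 2, e 1, e 0].getD k false
  have hg : IsTwist e g := ⟨h2, h3, h4, h5, rfl, rfl, rfl, rfl, rfl, rfl⟩
  obtain ⟨h6, h7⟩ := (hg.pinMatch.symm.trans h).eq_of_map_last (by omega) (by simp [hψ, twistPin])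
  exact ⟨by omega, h2, h3, h4, h5, (h7 0 (by omega)).symm, (h7 1 (by omega)).symm,
    (h7 2 (by omega)).symm, (h7 3 (by omega)).symm, (h7 4 (by omega)).symm,
    (h7 5 (by omega)).symm⟩

/-- Undoing one shift turns the image `2` of the last pin into `1`, which is the case of `isShift`.
-/
theorem isShift_isShift (h : PinMatch 4 d e f ψ χ) (hψ : ψ 4 = 2) :
    d % 2 = 0 ∧ ∃ g, IsShift 4 e g ∧ IsShift 4 g f := by
  obtain ⟨h2, h3, h4⟩ := h.of_map_four_eq_two hψ
  let g : ℕ → Bool := fun k => if k < 4 then e (k + 1) else e 1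
  have hg : IsShift 4 e g :=
    ⟨fun k hk hk4 => by interval_cases k <;> assumption, h4, fun k hk => by simp [g, hk],
      by simp [g]⟩
  obtain ⟨h5, h6⟩ := ((hg.pinMatch (by omega)).symm.trans h).isShift (by omega)
    (by simp [hψ, unshiftPin])
  exact ⟨by omega, g, hg, h6⟩

end PinMatch

/-- `2 × 4` choices: of the axis `0`, and of the quadrant of the first pin. -/
abbrev Choice := Bool × Bool × Bool

/-- The word with the first pin given by `s` and the signs negated from `lo` to `hi - 1`. -/
def signWord (lo hi n : ℕ) (s : Choice) : Word := mkWord s.1 (signs s.2.1 s.2.2 lo hi) n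

/-- The word whose pins turn around the origin once between the first and the last pin. -/
def turnWord (n : ℕ) (s : Choice) : Word := signWord 2 n n s

/-- The word which places the first pin of `turnWord n s` last. -/
def shiftWord (n : ℕ) (s : Choice) : Word := signWord 1 (n - 1) n (!s.1, s.2.2, s.2.1)

/-- The words of length five in the exceptional collisions. -/
def twistWord (s : Choice) : Word :=
  mkWord s.1 (fun k => [s.2.1, s.2.2, s.2.1, !s.2.2, !s.2.1, !s.2.2].getD k false) 5

def twistChoice (s : Choice) : Choice := (!s.1, !s.2.2, !s.2.1)

theorem signWord_inj {lo hi n : ℕ} (hn : 2 ≤ n) :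
    Function.Injective (signWord lo hi n) := by
  rintro ⟨v, a, b⟩ ⟨v', a', b'⟩ h
  obtain ⟨h1, h2⟩ := (mkWord_inj hn).1 h
  have h3 := h2 0 (by omega)
  have h4 := h2 1 (by omega)
  simp only [signs, Bool.xor_left_inj] at h1 h3 h4
  simp_all

theorem shiftWord_inj {n : ℕ} (hn : 2 ≤ n) : Function.Injective (shiftWord n) := by
  rintro ⟨v, a, b⟩ ⟨v', a', b'⟩ h
  have := signWord_inj hn h
  simp_all

/-- For `n = 3` the signs `0` and `2` differ in a turn word and agree in a shift word; for `n ≥ 5`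
the signs `1` and `3` do so. -/
theorem turnWord_ne_shiftWord {n : ℕ} (hn : n = 3 ∨ 5 ≤ n) (s t : Choice) :
    turnWord n s ≠ shiftWord n t := by
  intro h
  have h2 := ((mkWord_inj (by omega)).1 h).2
  rcases hn with rfl | hn
  · have h0 := h2 0 (by omega)
    have h2 := h2 2 (by omega)
    simp [signs] at h0 h2
    simp [h0] at h2
  · have h1 := h2 1 (by omega)
    have h3 := h2 3 (by omega)
    rw [signs_of_notMem (by omega), signs_of_mem (by omega) (by omega)] at h1
    rw [signs_of_mem (by omega) (by omega), signs_of_mem (by omega) (by omega)] at h3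
    simp at h1 h3
    simp [h1] at h3

theorem IsShift.exists_eq {n : ℕ} {e f : ℕ → Bool} (h : IsShift n e f) (hn : 2 ≤ n) (v : Bool) :
    ∃ s, mkWord v e n = turnWord n s ∧ mkWord (!v) f n = shiftWord n s := by
  have he : ∀ k ≤ n, e k = signs (e 0) (e 1) 2 n k := by
    have hpar : ∀ k, (if k % 2 = 0 then e 0 else e 1) = e (k % 2) := by
      intro k; rcases Nat.mod_two_eq_zero_or_one k with h | h <;> simp [h]
    intro k hk
    rcases Nat.lt_or_ge k 2 with h2 | h2
    · rw [signs_of_notMem (by omega), hpar, show k % 2 = k by omega]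
    · rcases hk.lt_or_eq with hk | rfl
      · rw [signs_of_mem h2 hk, hpar, Bool.eq_not.2 (h.turn k h2 hk)]
      · rw [signs_of_notMem (by omega), hpar, h.last]
  refine ⟨(v, e 0, e 1), (mkWord_inj hn).2 ⟨rfl, he⟩, (mkWord_inj hn).2 ⟨rfl, fun k hk => ?_⟩⟩
  have hp : ∀ k, (if k % 2 = 0 then e 1 else e 0) = if (k + 1) % 2 = 0 then e 0 else e 1 := by
    intro k; split_ifs <;> first | rfl | omega
  rcases hk.lt_or_eq with hk | rfl
  · rw [h.shift k hk, he _ (by omega)]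
    by_cases hc : 1 ≤ k ∧ k < n - 1
    · rw [signs_of_mem (by omega) (by omega), signs_of_mem hc.1 hc.2, hp]
    · rw [signs_of_notMem (by omega), signs_of_notMem (by omega), hp]
  · rw [h.shift_last, he _ (by omega), signs_of_notMem (by omega), signs_of_notMem (by omega), hp,
      Nat.mod_mod]

theorem pinPerm_turnWord {n : ℕ} (hn : 2 ≤ n) (s : Choice) :
    (turnWord n s).pinPerm = (shiftWord n s).pinPerm := by
  obtain ⟨v, a, b⟩ := s
  have h : IsShift n (signs a b 2 n) (signs b a 1 (n - 1)) := by
    have hp : ∀ k, (if k % 2 = 0 then b else a) = if (k + 1) % 2 = 0 then a else b := by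
      intro k; split_ifs <;> first | rfl | omega
    refine ⟨fun k hk hkn => ?_, ?_, fun k hk => ?_, ?_⟩
    · rw [signs_of_mem hk hkn, signs_of_notMem (by omega), Nat.mod_mod]
      exact Bool.not_ne_self _
    · rw [signs_of_notMem (by omega), signs_of_notMem (by omega), Nat.mod_mod]
    · by_cases hc : 1 ≤ k ∧ k < n - 1
      · rw [signs_of_mem (by omega) (by omega), signs_of_mem (by omega) (by omega), hp]
      · rw [signs_of_notMem (by omega), signs_of_notMem (by omega), hp]
    · rw [signs_of_notMem (by omega), signs_of_notMem (by omega), hp, Nat.mod_mod]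
  have hv : axisShift v (!v) = 1 := by cases v <;> rfl
  exact PinMatch.pinPerm_eq (v := v) (v' := !v) (by omega) (by rw [hv]; exact h.pinMatch hn)

theorem IsTwist.exists_eq {e f : ℕ → Bool} (h : IsTwist e f) (v : Bool) :
    ∃ s, mkWord v e 5 = twistWord s ∧ mkWord (!v) f 5 = twistWord (twistChoice s) := by
  obtain ⟨h2, h3, h4, h5, f0, f1, f2, f3, f4, f5⟩ := h
  rw [← Bool.eq_not] at h3 h4 h5
  refine ⟨(v, e 0, e 1), (mkWord_inj (by omega)).2 ⟨rfl, fun k hk => ?_⟩,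
    (mkWord_inj (by omega)).2 ⟨rfl, fun k hk => ?_⟩⟩ <;> interval_cases k <;>
    simp [twistChoice, *]

theorem pinPerm_twistWord (s : Choice) :
    (twistWord s).pinPerm = (twistWord (twistChoice s)).pinPerm := by
  obtain ⟨v, a, b⟩ := s
  have h : IsTwist (fun k => [a, b, a, !b, !a, !b].getD k false)
      (fun k => [!b, !a, !b, !!a, !!b, !!a].getD k false) := by
    constructor <;> simp
  have hv : axisShift v (!v) = 1 := by cases v <;> rfl
  exact PinMatch.pinPerm_eq (v := v) (v' := !v) (by omega) (by rw [hv]; exact h.pinMatch)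

/-- The pin words which generate the same centred permutation. -/
theorem exists_choice_of_pinPerm_eq {n : ℕ} (hn : 2 ≤ n) {w w' : Word} (hw : w.IsPinWord)
    (hw' : w'.IsPinWord) (hl : w.length = n) (hl' : w'.length = n) (hne : w ≠ w')
    (h : w.pinPerm = w'.pinPerm) :
    (∃ s, w = turnWord n s ∧ w' = shiftWord n s ∨ w' = turnWord n s ∧ w = shiftWord n s) ∨
    (n = 4 ∧ ∃ s t, shiftWord 4 s = turnWord 4 t ∧
      (w = turnWord 4 s ∧ w' = shiftWord 4 t ∨ w' = turnWord 4 s ∧ w = shiftWord 4 t)) ∨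
    (n = 5 ∧ ∃ s, w = twistWord s ∧ w' = twistWord (twistChoice s) ∨
      w' = twistWord s ∧ w = twistWord (twistChoice s)) := by
  obtain ⟨v, e, he⟩ := hw.exists_eq_mkWord
  obtain ⟨v', f, hf⟩ := hw'.exists_eq_mkWord
  rw [hl] at he
  rw [hl'] at hf
  clear hl hl' hw hw'
  subst he hf
  obtain ⟨ψ, χ, hm⟩ := exists_pinMatch (by omega) h
  have hψ : ψ n ≠ n := fun hψ => by
    obtain ⟨h1, h2⟩ := hm.eq_of_map_last hn hψ
    refine hne ((mkWord_inj hn).2 ⟨?_, h2⟩)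
    by_contra hv
    simp [axisShift, hv] at h1
  have hodd : axisShift v v' % 2 = 1 → v' = !v ∧ v = !v' := fun h => by
    revert h
    cases v <;> cases v' <;> simp [axisShift]
  have heven : axisShift v v' % 2 = 0 → v = v' := fun h => by
    revert h
    cases v <;> cases v' <;> simp [axisShift]
  rcases hm.cases_of_map_last_ne hn hψ with (hψ | hχ) | ⟨rfl, hψ | hχ⟩ | ⟨rfl, hψ | hχ⟩
  · obtain ⟨h1, h2⟩ := hm.isShift hn hψ
    obtain ⟨s, h3, h4⟩ := h2.exists_eq hn v
    rw [← (hodd h1).1] at h4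
    exact .inl ⟨s, .inl ⟨h3, h4⟩⟩
  · obtain ⟨h1, h2⟩ := hm.symm.isShift hn hχ
    obtain ⟨s, h3, h4⟩ := h2.exists_eq hn v'
    rw [← (hodd h1).2] at h4
    exact .inl ⟨s, .inr ⟨h3, h4⟩⟩
  · obtain ⟨h1, g, h2, h2'⟩ := hm.isShift_isShift hψ
    obtain ⟨s, h3, h4⟩ := h2.exists_eq hn v
    obtain ⟨t, h5, h6⟩ := h2'.exists_eq hn (!v)
    rw [Bool.not_not, heven h1] at h6
    exact .inr (.inl ⟨rfl, s, t, h4.symm.trans h5, .inl ⟨h3, h6⟩⟩)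
  · obtain ⟨h1, g, h2, h2'⟩ := hm.symm.isShift_isShift hχ
    obtain ⟨s, h3, h4⟩ := h2.exists_eq hn v'
    obtain ⟨t, h5, h6⟩ := h2'.exists_eq hn (!v')
    rw [Bool.not_not, ← heven h1] at h6
    exact .inr (.inl ⟨rfl, s, t, h4.symm.trans h5, .inr ⟨h3, h6⟩⟩)
  · obtain ⟨h1, h2⟩ := hm.isTwist hψ
    obtain ⟨s, h3, h4⟩ := h2.exists_eq v
    rw [← (hodd h1).1] at h4
    exact .inr (.inr ⟨rfl, s, .inl ⟨h3, h4⟩⟩)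
  · obtain ⟨h1, h2⟩ := hm.symm.isTwist hχ
    obtain ⟨s, h3, h4⟩ := h2.exists_eq v'
    rw [← (hodd h1).2] at h4
    exact .inr (.inr ⟨rfl, s, .inr ⟨h3, h4⟩⟩)

/-! ### Maximal collisions -/

/-- All pin words which generate the same centred permutation as `w`. -/
def fibre (w : Word) : Set Word := {w' | w'.IsPinWord ∧ w'.pinPerm = w.pinPerm}

theorem length_eq_of_pinPerm_eq {w w' : Word} (h : w.pinPerm = w'.pinPerm) :
    w.length = w'.length :=
  congrArg CentredPerm.length h

theorem IsCollision.subset_fibre {S : Set Word} (hS : IsCollision S) {w : Word} (hw : w ∈ S) :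
    S ⊆ fibre w := by
  obtain ⟨-, hpin, σ, hσ⟩ := hS
  exact fun w' hw' => ⟨hpin w' hw', (hσ w' hw').trans (hσ w hw).symm⟩

theorem maximal_fibre {w : Word} (h : (fibre w).Nontrivial) : Maximal IsCollision (fibre w) := by
  refine ⟨⟨h, fun _ hw => hw.1, _, fun _ hw => hw.2⟩, fun T hT hwT => ?_⟩
  obtain ⟨w', hw'⟩ := h.nonempty
  refine (hT.subset_fibre (hwT hw')).trans fun w'' hw'' => ⟨hw''.1, hw''.2.trans hw'.2⟩

theorem IsCollision.exists_maximalCollisions {S : Set Word} (hS : IsCollision S) :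
    ∃ n, ∃ T ∈ maximalCollisions n, S ⊆ T := by
  obtain ⟨w, hw⟩ := hS.1.nonempty
  exact ⟨w.length, fibre w, ⟨maximal_fibre (hS.1.mono (hS.subset_fibre hw)),
    fun w' hw' => length_eq_of_pinPerm_eq hw'.2⟩, hS.subset_fibre hw⟩

theorem mem_maximalCollisions_iff {n : ℕ} {S : Set Word} :
    S ∈ maximalCollisions n ↔ ∃ w, w.length = n ∧ w ∈ S ∧ S = fibre w ∧ S.Nontrivial := by
  constructor
  · rintro ⟨hS, hl⟩
    obtain ⟨w, hw⟩ := hS.prop.1.nonempty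
    have hsub := hS.prop.subset_fibre hw
    exact ⟨w, hl w hw, hw, hsub.antisymm
      (hS.le_of_ge (maximal_fibre (hS.prop.1.mono hsub)).prop hsub), hS.prop.1⟩
  · rintro ⟨w, hl, hw, rfl, hn⟩
    exact ⟨maximal_fibre hn, fun w' hw' => (length_eq_of_pinPerm_eq hw'.2).trans hl⟩

/-- By `hcol` two words of one fibre share a block, and disjointness makes it the same block
throughout, so the blocks are exactly the nontrivial fibres. -/
theorem maximalCollisions_eq_range {n : ℕ} {ι : Type*} (B : ι → Finset Word)
    (hB : ∀ i, (B i).Nontrivial) (hpin : ∀ i, ∀ w ∈ B i, w.IsPinWord ∧ w.length = n)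
    (hperm : ∀ i, ∀ w ∈ B i, ∀ w' ∈ B i, w.pinPerm = w'.pinPerm)
    (hcol : ∀ w w' : Word, w.IsPinWord → w'.IsPinWord → w.length = n → w'.length = n → w ≠ w' →
      w.pinPerm = w'.pinPerm → ∃ i, w ∈ B i ∧ w' ∈ B i)
    (hdisj : ∀ i j, ∀ w ∈ B i, w ∈ B j → i = j) :
    maximalCollisions n = Set.range fun i => (B i : Set Word) := by
  have key : ∀ i, ∀ w ∈ B i, (B i : Set Word) = fibre w := by
    intro i w hw
    refine Set.Subset.antisymm (fun w' hw' => ⟨(hpin i w' hw').1, hperm i w' hw' w hw⟩) ?_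
    rintro w' ⟨hw', hp⟩
    obtain ⟨hw1, hl⟩ := hpin i w hw
    by_cases hne : w' = w
    · exact hne ▸ hw
    · obtain ⟨j, h1, h2⟩ := hcol w' w hw' hw1 ((length_eq_of_pinPerm_eq hp).trans hl) hl hne hp
      rw [hdisj i j w hw h2]
      exact h1
  ext S
  rw [mem_maximalCollisions_iff]
  constructor
  · rintro ⟨w, hl, hw, rfl, hn⟩
    obtain ⟨w', hw', hne⟩ := hn.exists_ne w
    obtain ⟨i, h1, h2⟩ := hcol w' w hw'.1 hw.1 ((length_eq_of_pinPerm_eq hw'.2).trans hl) hl hne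
      hw'.2
    exact ⟨i, key i w h2⟩
  · rintro ⟨i, rfl⟩
    obtain ⟨w, hw⟩ := (hB i).nonempty
    exact ⟨w, (hpin i w hw).2, hw, key i w hw, by simpa using hB i⟩

theorem injective_coe_of_disjoint {ι : Type*} {B : ι → Finset Word} (hB : ∀ i, (B i).Nontrivial)
    (hdisj : ∀ i j, ∀ w ∈ B i, w ∈ B j → i = j) :
    Function.Injective fun i => (B i : Set Word) := by
  intro i j h
  obtain ⟨w, hw⟩ := (hB i).nonempty
  exact hdisj i j w hw (Finset.coe_injective h ▸ hw)

theorem ncard_range_of_injective {ι α : Type*} {f : ι → α} (hf : Function.Injective f) :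
    (Set.range f).ncard = Nat.card ι := by
  rw [← Set.image_univ, Set.ncard_image_of_injective _ hf, Set.ncard_univ]

/-! ### The tables in terms of signs -/

theorem map_range_eq_rep {f : ℕ → Letter} {x y : Letter} {k : ℕ} (m : ℕ)
    (h : ∀ i < k, f (2 * i) = x ∧ f (2 * i + 1) = y) :
    (List.range (2 * k + m)).map f = rep [x, y] k ++ (List.range m).map fun i => f (2 * k + i) := by
  rw [List.range_add, List.map_append, List.map_map]
  congr 1
  clear m
  induction k with
  | zero => rfl
  | succ k ih =>
    rw [show 2 * (k + 1) = 2 * k + 1 + 1 by ring, List.range_succ, List.range_succ, List.map_append,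
      List.map_append, ih fun i hi => h i (by omega)]
    simp [rep, List.replicate_succ', h k (by omega)]

theorem singleton_append_rep (x y : Letter) (k : ℕ) : [x] ++ rep [y, x] k = rep [x, y] k ++ [x] := by
  induction k with
  | zero => rfl
  | succ k ih =>
    simp only [rep, List.replicate_succ, List.flatten_cons] at ih ⊢
    simp only [List.cons_append, List.nil_append] at ih ⊢
    rw [ih]

/-- The quadrant of the first pin. -/
def firstQuadrant (v a b : Bool) : Quadrant := if v then mkQuadrant b a else mkQuadrant a b

/-- Splits off `k` periods with constant signs `c`, `d`; the `m` remaining letters are few enough to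
be computed. -/
theorem signWord_eq {lo hi n k : ℕ} (m : ℕ) (hn : n = 2 * k + m + 1)
    (v a b c d : Bool) (h : ∀ i < k, signs a b lo hi (2 * (i + 1)) = c ∧
      signs a b lo hi (2 * (i + 1) + 1) = d) :
    signWord lo hi n (v, a, b) = ⟨firstQuadrant v (signs a b lo hi 0) (signs a b lo hi 1),
      rep [mkLetter v c, mkLetter (!v) d] k ++
      (List.range m).map fun i =>
        mkLetter (axisVertical v i) (signs a b lo hi (2 * (k + 1) + i))⟩ := by
  subst hn
  simp only [signWord, mkWord, Word.mk.injEq, firstQuadrant, Nat.add_sub_cancel]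
  refine ⟨trivial, ?_⟩
  rw [map_range_eq_rep m fun i hi => ⟨?_, ?_⟩]
  · congr 1
    refine List.map_congr_left fun i _ => ?_
    rw [show 2 * k + i + 2 = 2 * (k + 1) + i by ring]
    congr 1
    simp only [axisVertical]
    split_ifs <;> first | rfl | omega
  · rw [show 2 * i + 2 = 2 * (i + 1) by ring, (h i hi).1]
    simp [axisVertical]
  · rw [show 2 * i + 1 + 2 = 2 * (i + 1) + 1 by ring, (h i hi).2]
    simp [axisVertical]

theorem signWord_type1Even (v a b : Bool) (k : ℕ) :
    signWord (2 * k + 3) (2 * k + 5) (2 * k + 4) (v, a, b) =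
      ⟨firstQuadrant v a b, rep [mkLetter v a, mkLetter (!v) b] k ++
        [mkLetter v a, mkLetter (!v) (!b), mkLetter v (!a)]⟩ := by
  rw [signWord_eq (k := k) 3 rfl v a b a b fun i hi => by
    constructor <;> rw [signs_of_notMem (by omega)] <;> simp]
  simp [List.range_succ, axisVertical, signs, Nat.add_mod, Nat.mul_add]

theorem signWord_type1Odd (v a b : Bool) (k : ℕ) :
    signWord (2 * k + 2) (2 * k + 4) (2 * k + 3) (v, a, b) =
      ⟨firstQuadrant v a b, rep [mkLetter v a, mkLetter (!v) b] k ++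
        [mkLetter v (!a), mkLetter (!v) (!b)]⟩ := by
  rw [signWord_eq (k := k) 2 rfl v a b a b fun i hi => by
    constructor <;> rw [signs_of_notMem (by omega)] <;> simp]
  simp [List.range_succ, axisVertical, signs, Nat.add_mod, Nat.mul_add]

theorem signWord_type2Even (v a b : Bool) (k : ℕ) :
    signWord 2 (2 * k + 3) (2 * k + 2) (v, a, b) =
      ⟨firstQuadrant v a b, [mkLetter v (!a)] ++ rep [mkLetter (!v) (!b), mkLetter v (!a)] k⟩ := by
  rw [singleton_append_rep, signWord_eq (k := k) 1 rfl v a b (!a) (!b) fun i hi => by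
    constructor <;> rw [signs_of_mem (by omega) (by omega)] <;> simp]
  simp [List.range_succ, axisVertical, signs, Nat.add_mod, Nat.mul_add]

theorem signWord_type2Odd (v a b : Bool) (k : ℕ) :
    signWord 2 (2 * k + 2) (2 * k + 1) (v, a, b) =
      ⟨firstQuadrant v a b, rep [mkLetter v (!a), mkLetter (!v) (!b)] k⟩ := by
  rw [signWord_eq (k := k) 0 rfl v a b (!a) (!b) fun i hi => by
    constructor <;> rw [signs_of_mem (by omega) (by omega)] <;> simp]
  simp [axisVertical, signs, Nat.add_mod, Nat.mul_add]

theorem turnWord_even (v a b : Bool) (k : ℕ) :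
    turnWord (2 * k + 4) (v, a, b) =
      ⟨firstQuadrant v a b, rep [mkLetter v (!a), mkLetter (!v) (!b)] (k + 1) ++
        [mkLetter v a]⟩ := by
  rw [turnWord, signWord_eq (n := 2 * k + 4) (k := k + 1) 1 (by omega) v a b (!a) (!b) fun i hi => by
    constructor <;> rw [signs_of_mem (by omega) (by omega)] <;> simp]
  simp [List.range_succ, axisVertical, signs, Nat.add_mod, Nat.mul_add]

theorem turnWord_odd (v a b : Bool) (k : ℕ) :
    turnWord (2 * k + 3) (v, a, b) =
      ⟨firstQuadrant v a b, rep [mkLetter v (!a), mkLetter (!v) (!b)] k ++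
        [mkLetter v (!a), mkLetter (!v) b]⟩ := by
  rw [turnWord, signWord_eq (k := k) 2 rfl v a b (!a) (!b) fun i hi => by
    constructor <;> rw [signs_of_mem (by omega) (by omega)] <;> simp]
  simp [List.range_succ, axisVertical, signs, Nat.add_mod, Nat.mul_add]

theorem shiftWord_even (v a b : Bool) (k : ℕ) :
    shiftWord (2 * k + 4) (v, a, b) =
      ⟨firstQuadrant (!v) b (!a), rep [mkLetter (!v) (!b), mkLetter v (!a)] k ++
        [mkLetter (!v) (!b), mkLetter v a, mkLetter (!v) b]⟩ := by
  rw [shiftWord, signWord_eq (k := k) 3 rfl (!v) b a (!b) (!a) fun i hi => by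
    constructor <;> rw [signs_of_mem (by omega) (by omega)] <;> simp]
  simp [List.range_succ, axisVertical, signs, Nat.add_mod, Nat.mul_add]

theorem shiftWord_odd (v a b : Bool) (k : ℕ) :
    shiftWord (2 * k + 3) (v, a, b) =
      ⟨firstQuadrant (!v) b (!a), rep [mkLetter (!v) (!b), mkLetter v (!a)] k ++
        [mkLetter (!v) b, mkLetter v a]⟩ := by
  rw [shiftWord, signWord_eq (k := k) 2 rfl (!v) b a (!b) (!a) fun i hi => by
    constructor <;> rw [signs_of_mem (by omega) (by omega)] <;> simp]
  simp [List.range_succ, axisVertical, signs, Nat.add_mod, Nat.mul_add]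

theorem range_choice {α : Type*} (f : Choice → α) :
    Set.range f = {f (true, true, true), f (true, true, false), f (true, false, true),
      f (true, false, false), f (false, true, true), f (false, true, false), f (false, false, true),
      f (false, false, false)} := by
  ext x
  simp only [Set.mem_range, Prod.exists, Bool.exists_bool, Set.mem_insert_iff,
    Set.mem_singleton_iff, eq_comm (a := x)]
  tauto

theorem type1Even_eq (k : ℕ) :
    type1Even k = Set.range (signWord (2 * k + 3) (2 * k + 5) (2 * k + 4)) := by
  simp only [range_choice, signWord_type1Even, type1Even, firstQuadrant, mkQuadrant, mkLetter,
    Bool.not_true, Bool.not_false, if_true, Bool.false_eq_true, if_false]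
  ext w
  simp only [Set.mem_insert_iff, Set.mem_singleton_iff]
  tauto

theorem type1Odd_eq (k : ℕ) :
    type1Odd k = Set.range (signWord (2 * k + 2) (2 * k + 4) (2 * k + 3)) := by
  simp only [range_choice, signWord_type1Odd, type1Odd, firstQuadrant, mkQuadrant, mkLetter,
    Bool.not_true, Bool.not_false, if_true, Bool.false_eq_true, if_false]
  ext w
  simp only [Set.mem_insert_iff, Set.mem_singleton_iff]
  tauto

theorem type2Even_eq (k : ℕ) :
    type2Even k = Set.range (signWord 2 (2 * k + 3) (2 * k + 2)) := by
  simp only [range_choice, signWord_type2Even, type2Even, firstQuadrant, mkQuadrant, mkLetter,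
    Bool.not_true, Bool.not_false, if_true, Bool.false_eq_true, if_false]
  ext w
  simp only [Set.mem_insert_iff, Set.mem_singleton_iff]
  tauto

theorem type2Odd_eq (k : ℕ) :
    type2Odd k = Set.range (signWord 2 (2 * k + 2) (2 * k + 1)) := by
  simp only [range_choice, signWord_type2Odd, type2Odd, firstQuadrant, mkQuadrant, mkLetter,
    Bool.not_true, Bool.not_false, if_true, Bool.false_eq_true, if_false]
  ext w
  simp only [Set.mem_insert_iff, Set.mem_singleton_iff]
  tauto

/-- The two words of a regular collision. -/
def pairBlock (n : ℕ) (s : Choice) : Finset Word := {turnWord n s, shiftWord n s}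

theorem collisionsEven_eq (k : ℕ) :
    collisionsEven k = Set.range fun s => (pairBlock (2 * k + 4) s : Set Word) := by
  simp only [range_choice, pairBlock, Finset.coe_insert, Finset.coe_singleton, turnWord_even,
    shiftWord_even, collisionsEven, firstQuadrant, mkQuadrant, mkLetter,
    Bool.not_true, Bool.not_false, if_true, Bool.false_eq_true, if_false]
  ext S
  simp only [Set.mem_insert_iff, Set.mem_singleton_iff]
  tauto

theorem collisionsOdd_eq (k : ℕ) :
    collisionsOdd k = Set.range fun s => (pairBlock (2 * k + 3) s : Set Word) := by
  simp only [range_choice, pairBlock, Finset.coe_insert, Finset.coe_singleton, turnWord_odd,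
    shiftWord_odd, collisionsOdd, firstQuadrant, mkQuadrant, mkLetter,
    Bool.not_true, Bool.not_false, if_true, Bool.false_eq_true, if_false]
  ext S
  simp only [Set.mem_insert_iff, Set.mem_singleton_iff]
  tauto

/-! ### The decomposable pin words -/

theorem boxDecomposables_eq {n : ℕ} (hn : 2 ≤ n) :
    boxDecomposables n =
      {w | 3 ≤ n ∧ w ∈ Set.range (signWord (n - 1) (n + 1) n)} ∪
        Set.range (signWord 2 (n + 1) n) := by
  ext w
  constructor
  · rintro ⟨hw, rfl, hd⟩
    obtain ⟨v, e, he⟩ := hw.exists_eq_mkWord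
    generalize w.length = n at *
    subst he
    obtain ⟨a, b, ⟨h3, h⟩ | h⟩ := (isBoxDecomposable_mkWord_iff_signs v e hn).1 hd
    · exact .inl ⟨h3, (v, a, b), (mkWord_inj hn).2 ⟨rfl, fun k hk => (h k hk).symm⟩⟩
    · exact .inr ⟨(v, a, b), (mkWord_inj hn).2 ⟨rfl, fun k hk => (h k hk).symm⟩⟩
  · rintro (⟨h3, ⟨v, a, b⟩, rfl⟩ | ⟨⟨v, a, b⟩, rfl⟩) <;>
      refine ⟨isPinWord_mkWord _ _ _, length_mkWord _ _ (by omega),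
        (isBoxDecomposable_mkWord_iff_signs _ _ hn).2 ⟨a, b, ?_⟩⟩
    · exact .inl ⟨h3, fun _ _ => rfl⟩
    · exact .inr fun _ _ => rfl

/-- Lengths add under `boxSum`, and two lengths below `1` do not add up to `1`. -/
theorem boxDecomposables_one : boxDecomposables 1 = ∅ := by
  refine Set.eq_empty_of_forall_notMem ?_
  rintro w ⟨-, hl, π, σ, hπ, hσ, h⟩
  have h1 : w.pinPerm.length = w.length := rfl
  have h2 : w.pinPerm.length = π.length + σ.length := congrArg CentredPerm.length h
  omega

theorem boxDecomposables_eq_union {n : ℕ} (hn : 3 ≤ n) :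
    boxDecomposables n = Set.range (signWord (n - 1) (n + 1) n) ∪
      Set.range (signWord 2 (n + 1) n) := by
  rw [boxDecomposables_eq (by omega)]
  ext w
  simp only [Set.mem_union, Set.mem_ofPred_eq, hn, true_and]

theorem decomposables2_eq : decomposables2 = Set.range (signWord 2 3 2) := by
  rw [← type2Even_eq 0]
  ext w
  simp only [decomposables2, type2Even, rep, List.replicate_zero, List.flatten_nil, List.append_nil,
    Set.mem_insert_iff, Set.mem_singleton_iff]
  tauto

theorem decomposables3_eq : decomposables3 = Set.range (signWord 2 4 3) := by
  rw [← type2Odd_eq 1]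
  ext w
  simp only [decomposables3, type2Odd, rep, List.replicate_one, List.flatten_singleton,
    Set.mem_insert_iff, Set.mem_singleton_iff]
  tauto

theorem ncard_range_signWord {lo hi n : ℕ} (hn : 2 ≤ n) :
    (Set.range (signWord lo hi n)).ncard = 8 := by
  rw [ncard_range_of_injective (signWord_inj hn), Nat.card_eq_fintype_card]
  rfl

/-- The signs `0` and `2` agree in the first family, as `2 < n - 1`, and differ in the second. -/
theorem disjoint_range_signWord {n : ℕ} (hn : 4 ≤ n) :
    Disjoint (Set.range (signWord (n - 1) (n + 1) n)) (Set.range (signWord 2 (n + 1) n)) := by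
  rw [Set.disjoint_left]
  rintro _ ⟨s, rfl⟩ ⟨t, h⟩
  have h2 := ((mkWord_inj (by omega)).1 h).2
  have h0 := h2 0 (by omega)
  have h2 := h2 2 (by omega)
  rw [signs_of_notMem (by omega), signs_of_notMem (by omega)] at h0
  rw [signs_of_mem (by omega) (by omega), signs_of_notMem (by omega)] at h2
  simp only [Nat.zero_mod, Nat.mod_self, if_true] at h0 h2
  simp [h0] at h2

/-! ### The collisions -/

theorem signWord_mem {lo hi n : ℕ} (hn : 1 ≤ n) (s : Choice) :
    (signWord lo hi n s).IsPinWord ∧ (signWord lo hi n s).length = n :=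
  ⟨isPinWord_mkWord _ _ _, length_mkWord _ _ hn⟩

theorem pairBlock_mem {n : ℕ} (hn : 1 ≤ n) (s : Choice) :
    ∀ w ∈ pairBlock n s, w.IsPinWord ∧ w.length = n := by
  simp only [pairBlock, Finset.mem_insert, Finset.mem_singleton]
  rintro w (rfl | rfl)
  · exact signWord_mem hn _
  · exact signWord_mem hn _

theorem pairBlock_pinPerm {n : ℕ} (hn : 2 ≤ n) (s : Choice) :
    ∀ w ∈ pairBlock n s, ∀ w' ∈ pairBlock n s, w.pinPerm = w'.pinPerm := by
  simp only [pairBlock, Finset.mem_insert, Finset.mem_singleton]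
  have := pinPerm_turnWord hn s
  rintro w (rfl | rfl) w' (rfl | rfl) <;> simp [this]

theorem pairBlock_nontrivial {n : ℕ} (hn : n = 3 ∨ 5 ≤ n) (s : Choice) :
    (pairBlock n s).Nontrivial :=
  Finset.nontrivial_iff_ne_singleton (by simp [pairBlock] : turnWord n s ∈ pairBlock n s) |>.2
    fun h => turnWord_ne_shiftWord hn s s (by
      have : shiftWord n s ∈ pairBlock n s := by simp [pairBlock]
      rw [h] at this
      exact (Finset.mem_singleton.1 this).symm)

theorem pairBlock_disjoint {n : ℕ} (hn : n = 3 ∨ 5 ≤ n) (s t : Choice) :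
    ∀ w ∈ pairBlock n s, w ∈ pairBlock n t → s = t := by
  have hn2 : 2 ≤ n := by omega
  simp only [pairBlock, Finset.mem_insert, Finset.mem_singleton]
  rintro w (rfl | rfl) (h | h)
  · exact signWord_inj hn2 h
  · exact absurd h (turnWord_ne_shiftWord hn s t)
  · exact absurd h.symm (turnWord_ne_shiftWord hn t s)
  · exact shiftWord_inj hn2 h

theorem exists_pairBlock {n : ℕ} (hn : 2 ≤ n) (hn4 : n ≠ 4) (hn5 : n ≠ 5) (w w' : Word)
    (hw : w.IsPinWord) (hw' : w'.IsPinWord) (hl : w.length = n) (hl' : w'.length = n)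
    (hne : w ≠ w') (h : w.pinPerm = w'.pinPerm) : ∃ s, w ∈ pairBlock n s ∧ w' ∈ pairBlock n s := by
  rcases exists_choice_of_pinPerm_eq hn hw hw' hl hl' hne h with ⟨s, hs⟩ | ⟨h4, -⟩ | ⟨h5, -⟩
  · refine ⟨s, ?_⟩
    rcases hs with ⟨rfl, rfl⟩ | ⟨rfl, rfl⟩ <;> simp [pairBlock]
  · exact absurd h4 hn4
  · exact absurd h5 hn5

theorem maximalCollisions_eq_pairs {n : ℕ} (hn : n = 3 ∨ 6 ≤ n) :
    maximalCollisions n = Set.range fun s => (pairBlock n s : Set Word) :=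
  maximalCollisions_eq_range _ (pairBlock_nontrivial (by omega)) (pairBlock_mem (by omega))
    (pairBlock_pinPerm (by omega)) (exists_pairBlock (by omega) (by omega) (by omega))
    (pairBlock_disjoint (by omega))

theorem ncard_pairs {n : ℕ} (hn : n = 3 ∨ 5 ≤ n) :
    (Set.range fun s => (pairBlock n s : Set Word)).ncard = 8 := by
  rw [ncard_range_of_injective (injective_coe_of_disjoint (pairBlock_nontrivial hn)
    (pairBlock_disjoint hn)), Nat.card_eq_fintype_card]
  rfl

theorem collisions3_eq : collisions3 = Set.range fun s => (pairBlock 3 s : Set Word) := by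
  -- The table of length three lists each pair in the opposite order to `collisionsOdd 0`.
  have h := fun q t => Set.pair_comm (⟨q, t⟩ : Word)
  rw [← collisionsOdd_eq 0, collisions3, h .one [.u, .l], h .one [.r, .d], h .two [.u, .r],
    h .two [.l, .d], h .three [.l, .u], h .three [.d, .r], h .four [.r, .u], h .four [.d, .l]]
  ext S
  simp only [collisionsOdd, rep, List.replicate_zero, List.flatten_nil, List.nil_append,
    Set.mem_insert_iff, Set.mem_singleton_iff]
  tauto

theorem regularCollisions5_eq :
    regularCollisions5 = Set.range fun s => (pairBlock 5 s : Set Word) := by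
  rw [← collisionsOdd_eq 1]
  ext S
  simp only [regularCollisions5, collisionsOdd, rep, List.replicate_one, List.flatten_singleton,
    List.cons_append, List.nil_append, Set.mem_insert_iff, Set.mem_singleton_iff]
  tauto

/-- The collision of length two with the given quadrant. -/
def pairBlock2 (q : Bool × Bool) : Finset Word := pairBlock 2 (q.1 == q.2, q.1, q.2)

theorem range_bool_prod {α : Type*} (f : Bool × Bool → α) :
    Set.range f = {f (true, true), f (false, true), f (false, false), f (true, false)} := by
  ext x
  simp only [Set.mem_range, Prod.exists, Bool.exists_bool, Set.mem_insert_iff,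
    Set.mem_singleton_iff, eq_comm (a := x)]
  tauto

/-- The axis `q.1 == q.2` in `pairBlock2` makes the numeral `mkQuadrant q.1 q.2` and lists the words
in the order of the table. -/
theorem collisions2_eq : collisions2 = Set.range fun q => (pairBlock2 q : Set Word) := by
  simp only [range_bool_prod, pairBlock2, pairBlock, Finset.coe_insert, Finset.coe_singleton]
  rfl

theorem pairBlock2_nontrivial (q : Bool × Bool) : (pairBlock2 q).Nontrivial := by
  rw [← Finset.one_lt_card_iff_nontrivial]
  decide +revert

theorem pairBlock2_disjoint : ∀ q q', ∀ w ∈ pairBlock2 q, w ∈ pairBlock2 q' → q = q' := by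
  decide

theorem maximalCollisions_two : maximalCollisions 2 = collisions2 := by
  rw [collisions2_eq]
  refine maximalCollisions_eq_range _ pairBlock2_nontrivial
    (fun q => pairBlock_mem (by omega) _) (fun q => pairBlock_pinPerm le_rfl _) ?_
    pairBlock2_disjoint
  intro w w' hw hw' hl hl' hne h
  obtain ⟨s, hs⟩ := exists_pairBlock le_rfl (by omega) (by omega) w w' hw hw' hl hl' hne h
  -- For `n = 2` no sign is negated, so `(v, a, b)` and `(!v, b, a)` give the same pair.
  have : ∀ s, ∃ q, pairBlock 2 s = pairBlock2 q := by decide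
  obtain ⟨q, hq⟩ := this s
  exact ⟨q, hq ▸ hs⟩

/-- The collisions of length four. -/
def quadBlock (v : Bool) : Finset Word :=
  {turnWord 4 (v, true, true), shiftWord 4 (v, true, true), turnWord 4 (v, false, false),
    shiftWord 4 (v, false, false)}

theorem collisions4_eq : collisions4 = Set.range fun v => (quadBlock v : Set Word) := by
  have h : ∀ f : Bool → Set Word, Set.range f = {f false, f true} := fun f => by
    ext x; simp
  have h1 : (quadBlock false : Set Word) = {⟨.one, [.l, .d, .r]⟩, ⟨.two, [.d, .r, .u]⟩,
      ⟨.three, [.r, .u, .l]⟩, ⟨.four, [.u, .l, .d]⟩} := by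
    simp only [quadBlock, Finset.coe_insert, Finset.coe_singleton]; rfl
  have h2 : (quadBlock true : Set Word) = {⟨.one, [.d, .l, .u]⟩, ⟨.four, [.l, .u, .r]⟩,
      ⟨.three, [.u, .r, .d]⟩, ⟨.two, [.r, .d, .l]⟩} := by
    simp only [quadBlock, Finset.coe_insert, Finset.coe_singleton]; rfl
  rw [h, h1, h2, collisions4]
  congr 2
  ext w
  simp only [Set.mem_insert_iff, Set.mem_singleton_iff]
  tauto

theorem quadBlock_nontrivial (v : Bool) : (quadBlock v).Nontrivial := by
  rw [← Finset.one_lt_card_iff_nontrivial]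
  decide +revert

theorem quadBlock_disjoint : ∀ v v', ∀ w ∈ quadBlock v, w ∈ quadBlock v' → v = v' := by
  decide

/-- For `n = 4` the shift word of `(v, a, b)` is the turn word of `(!v, b, !a)`; three consecutive
shifts link the four words. -/
theorem pinPerm_quadBlock (v : Bool) {w : Word} (hw : w ∈ quadBlock v) :
    w.pinPerm = (turnWord 4 (v, true, true)).pinPerm := by
  have h := fun s => pinPerm_turnWord (n := 4) (by omega) s
  have h1 : shiftWord 4 (v, true, true) = turnWord 4 (!v, true, false) := by decide +revert
  have h2 : shiftWord 4 (!v, true, false) = turnWord 4 (v, false, false) := by decide +revert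
  have h3 := h (v, true, true)
  have h4 := h (!v, true, false)
  have h5 := h (v, false, false)
  rw [h1] at h3
  rw [h2] at h4
  simp only [quadBlock, Finset.mem_insert, Finset.mem_singleton] at hw
  rcases hw with rfl | rfl | rfl | rfl
  · rfl
  · rw [h1, h3]
  · rw [h3, h4]
  · rw [h3, h4, h5]

theorem maximalCollisions_four : maximalCollisions 4 = collisions4 := by
  rw [collisions4_eq]
  refine maximalCollisions_eq_range _ quadBlock_nontrivial ?_
    (fun v w hw w' hw' => (pinPerm_quadBlock v hw).trans (pinPerm_quadBlock v hw').symm) ?_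
    quadBlock_disjoint
  · intro v w hw
    simp only [quadBlock, Finset.mem_insert, Finset.mem_singleton] at hw
    rcases hw with rfl | rfl | rfl | rfl <;> exact signWord_mem (by omega) _
  · intro w w' hw hw' hl hl' hne h
    have h1 : ∀ s, ∃ v, turnWord 4 s ∈ quadBlock v ∧ shiftWord 4 s ∈ quadBlock v := by decide
    rcases exists_choice_of_pinPerm_eq (by omega) hw hw' hl hl' hne h with
      ⟨s, hs⟩ | ⟨-, s, t, hst, hs⟩ | ⟨h5, -⟩
    · obtain ⟨v, hv, hv'⟩ := h1 s
      rcases hs with ⟨rfl, rfl⟩ | ⟨rfl, rfl⟩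
      · exact ⟨v, hv, hv'⟩
      · exact ⟨v, hv', hv⟩
    · obtain ⟨v, hv, hv'⟩ := h1 s
      obtain ⟨v', ht, ht'⟩ := h1 t
      -- The intermediate word of the double shift lies in both blocks.
      obtain rfl := quadBlock_disjoint v v' _ hv' (hst ▸ ht)
      rcases hs with ⟨rfl, rfl⟩ | ⟨rfl, rfl⟩
      · exact ⟨v, hv, ht'⟩
      · exact ⟨v, ht', hv⟩
    · omega

/-- The exceptional collisions of length five. -/
def twistBlock (q : Bool × Bool) : Finset Word :=
  {twistWord (q.1, q.2 || q.1, q.2 || !q.1),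
    twistWord (twistChoice (q.1, q.2 || q.1, q.2 || !q.1))}

/-- `twistChoice` is an involution without fixed points; `twistBlock` names one choice from each of
its four orbits, following the table. -/
theorem pathologicalCollisions5_eq :
    pathologicalCollisions5 = Set.range fun q => (twistBlock q : Set Word) := by
  have h : ∀ f : Bool × Bool → Set Word,
      Set.range f = {f (true, true), f (false, true), f (true, false), f (false, false)} :=
    fun f => by rw [range_bool_prod, Set.pair_comm (f (false, false))]
  simp only [h, twistBlock, Finset.coe_insert, Finset.coe_singleton]
  rfl

/-- The collisions of length five. -/
def blocks5 : (Bool × Bool) ⊕ Choice → Finset Word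
  | .inl q => twistBlock q
  | .inr s => pairBlock 5 s

theorem blocks5_nontrivial (i : (Bool × Bool) ⊕ Choice) : (blocks5 i).Nontrivial := by
  rcases i with q | s
  · rw [← Finset.one_lt_card_iff_nontrivial, blocks5]
    decide +revert
  · exact pairBlock_nontrivial (by omega) s

theorem blocks5_disjoint : ∀ i j, ∀ w ∈ blocks5 i, w ∈ blocks5 j → i = j := by
  decide +kernel

theorem maximalCollisions_five :
    maximalCollisions 5 = pathologicalCollisions5 ∪ regularCollisions5 := by
  have hr : pathologicalCollisions5 ∪ regularCollisions5 =
      Set.range fun i => (blocks5 i : Set Word) := by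
    rw [pathologicalCollisions5_eq, regularCollisions5_eq, ← Set.Sum.elim_range]
    congr 1
    funext i
    cases i <;> rfl
  rw [hr]
  refine maximalCollisions_eq_range _ blocks5_nontrivial ?_ ?_ ?_ blocks5_disjoint
  · rintro (q | s)
    · simp only [blocks5, twistBlock, Finset.mem_insert, Finset.mem_singleton]
      rintro w (rfl | rfl) <;>
        exact ⟨isPinWord_mkWord _ _ _, length_mkWord _ _ (by omega)⟩
    · exact pairBlock_mem (by omega) s
  · rintro (q | s)
    · simp only [blocks5, twistBlock, Finset.mem_insert, Finset.mem_singleton]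
      have := pinPerm_twistWord (q.1, q.2 || q.1, q.2 || !q.1)
      rintro w (rfl | rfl) w' (rfl | rfl) <;> simp only [this]
    · exact pairBlock_pinPerm (by omega) s
  · intro w w' hw hw' hl hl' hne h
    rcases exists_choice_of_pinPerm_eq (by omega) hw hw' hl hl' hne h with
      ⟨s, hs⟩ | ⟨h4, -⟩ | ⟨-, s, hs⟩
    · refine ⟨.inr s, ?_⟩
      rcases hs with ⟨rfl, rfl⟩ | ⟨rfl, rfl⟩ <;> simp [blocks5, pairBlock]
    · omega
    · have : ∀ s, ∃ q, twistWord s ∈ twistBlock q ∧ twistWord (twistChoice s) ∈ twistBlock q := by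
        decide +kernel
      obtain ⟨q, h1, h2⟩ := this s
      refine ⟨.inl q, ?_⟩
      rcases hs with ⟨rfl, rfl⟩ | ⟨rfl, rfl⟩
      · exact ⟨h1, h2⟩
      · exact ⟨h2, h1⟩

theorem disjoint_collisions5 : Disjoint pathologicalCollisions5 regularCollisions5 := by
  rw [pathologicalCollisions5_eq, regularCollisions5_eq, Set.disjoint_left]
  rintro _ ⟨q, rfl⟩ ⟨s, h⟩
  exact absurd (injective_coe_of_disjoint blocks5_nontrivial blocks5_disjoint
    (a₁ := .inr s) (a₂ := .inl q) h) (by simp)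

/-- A match fixes the origin and hence the only pin, whose two signs determine the quadrant. -/
theorem maximalCollisions_one : maximalCollisions 1 = ∅ := by
  have key : ∀ q q' : Quadrant, (⟨q, []⟩ : Word).pinPerm = (⟨q', []⟩ : Word).pinPerm → q = q' := by
    have hq : ∀ q, ∃ a b, q = mkQuadrant a b := by intro q; cases q <;> decide
    intro q q' h
    obtain ⟨a, b, rfl⟩ := hq q
    obtain ⟨c, d, rfl⟩ := hq q'
    obtain ⟨ψ, χ, hm⟩ := exists_pinMatch (v := false) (v' := false)
      (e := fun k => if k = 0 then a else b) (f := fun k => if k = 0 then c else d) le_rfl h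
    have h1 : ψ 1 = 1 := by
      have := hm.map_le 1 le_rfl
      by_contra h0
      have := hm.map_inj (a := 1) (b := 0) le_rfl (by omega) (by rw [hm.map_zero]; omega)
      omega
    have hx := hm.sign 0 one_ne_zero le_rfl
    have hy := hm.sign 1 one_ne_zero le_rfl
    rw [h1] at hx hy
    simp [axisShift, block] at hx hy
    rw [hx, hy]
  refine Set.eq_empty_of_forall_notMem fun S hS => ?_
  obtain ⟨⟨hS, -⟩, hl⟩ := hS
  obtain ⟨hnt, -, σ, hσ⟩ := hS
  obtain ⟨⟨q, t⟩, hw, ⟨q', t'⟩, hw', hne⟩ := hnt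
  have h1 := hl _ hw
  have h2 := hl _ hw'
  simp only [Word.length, Nat.add_eq_right, List.length_eq_zero_iff] at h1 h2
  subst h1 h2
  exact hne (by rw [key q q' ((hσ _ hw).trans (hσ _ hw').symm)])

end PinClass

open PinClass

theorem mainTheorem4 :
    -- the complete list of box-decomposable pin words, by length
    (PinClass.boxDecomposables 1 = ∅ ∧
      PinClass.boxDecomposables 2 = PinClass.decomposables2 ∧
      PinClass.boxDecomposables 3 = PinClass.decomposables3 ∧
      (∀ k : ℕ, PinClass.boxDecomposables (2 * k + 4) =
        PinClass.type1Even k ∪ PinClass.type2Even (k + 1)) ∧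
      (∀ k : ℕ, PinClass.boxDecomposables (2 * k + 5) =
        PinClass.type1Odd (k + 1) ∪ PinClass.type2Odd (k + 2))) ∧
    -- the total numbers in that list
    (PinClass.decomposables2.ncard = 8 ∧
      PinClass.decomposables3.ncard = 8 ∧
      (∀ k : ℕ, (PinClass.type1Even k).ncard = 8 ∧ (PinClass.type2Even (k + 1)).ncard = 8 ∧
        Disjoint (PinClass.type1Even k) (PinClass.type2Even (k + 1))) ∧
      (∀ k : ℕ, (PinClass.type1Odd (k + 1)).ncard = 8 ∧ (PinClass.type2Odd (k + 2)).ncard = 8 ∧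
        Disjoint (PinClass.type1Odd (k + 1)) (PinClass.type2Odd (k + 2)))) ∧
    -- every collision is part of a maximal one, and all its words have the same length
    (∀ S : Set PinClass.Word, PinClass.IsCollision S →
      ∃ n : ℕ, ∃ T ∈ PinClass.maximalCollisions n, S ⊆ T) ∧
    -- the complete list of maximal collisions, by length
    (PinClass.maximalCollisions 1 = ∅ ∧
      PinClass.maximalCollisions 2 = PinClass.collisions2 ∧
      PinClass.maximalCollisions 3 = PinClass.collisions3 ∧
      PinClass.maximalCollisions 4 = PinClass.collisions4 ∧
      PinClass.maximalCollisions 5 =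
        PinClass.pathologicalCollisions5 ∪ PinClass.regularCollisions5 ∧
      (∀ k : ℕ, PinClass.maximalCollisions (2 * k + 6) = PinClass.collisionsEven (k + 1)) ∧
      (∀ k : ℕ, PinClass.maximalCollisions (2 * k + 7) = PinClass.collisionsOdd (k + 2))) ∧
    -- the total numbers in that list
    (PinClass.collisions2.ncard = 4 ∧
      PinClass.collisions3.ncard = 8 ∧
      PinClass.collisions4.ncard = 2 ∧
      PinClass.pathologicalCollisions5.ncard = 4 ∧
      PinClass.regularCollisions5.ncard = 8 ∧
      Disjoint PinClass.pathologicalCollisions5 PinClass.regularCollisions5 ∧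
      (∀ k : ℕ, (PinClass.collisionsEven (k + 1)).ncard = 8) ∧
      (∀ k : ℕ, (PinClass.collisionsOdd (k + 2)).ncard = 8)) := by
  refine ⟨⟨boxDecomposables_one, ?_, ?_, fun k => ?_, fun k => ?_⟩,
    ⟨?_, ?_, fun k => ?_, fun k => ?_⟩, fun S hS => hS.exists_maximalCollisions,
    ⟨?_, maximalCollisions_two, ?_, maximalCollisions_four, maximalCollisions_five, fun k => ?_,
      fun k => ?_⟩,
    ?_, ?_, ?_, ?_, ?_, disjoint_collisions5, fun k => ?_, fun k => ?_⟩
  · rw [boxDecomposables_eq le_rfl, decomposables2_eq]; simp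
  -- For `n = 3` the two families coincide, because `n - 1 = 2`.
  · rw [boxDecomposables_eq_union le_rfl, decomposables3_eq, Set.union_self]
  · rw [boxDecomposables_eq_union (by omega), type1Even_eq, type2Even_eq]; rfl
  · rw [boxDecomposables_eq_union (by omega), type1Odd_eq, type2Odd_eq]; rfl
  · rw [decomposables2_eq, ncard_range_signWord le_rfl]
  · rw [decomposables3_eq, ncard_range_signWord (by omega)]
  · rw [type1Even_eq, type2Even_eq]
    exact ⟨ncard_range_signWord (by omega), ncard_range_signWord (by omega),
      disjoint_range_signWord (n := 2 * k + 4) (by omega)⟩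
  · rw [type1Odd_eq, type2Odd_eq]
    exact ⟨ncard_range_signWord (by omega), ncard_range_signWord (by omega),
      disjoint_range_signWord (n := 2 * k + 5) (by omega)⟩
  · exact maximalCollisions_one
  · rw [maximalCollisions_eq_pairs (.inl rfl), collisions3_eq]
  · rw [maximalCollisions_eq_pairs (.inr (by omega)), collisionsEven_eq]; rfl
  · rw [maximalCollisions_eq_pairs (.inr (by omega)), collisionsOdd_eq]; rfl
  · rw [collisions2_eq, ncard_range_of_injective (injective_coe_of_disjoint pairBlock2_nontrivial
      pairBlock2_disjoint), Nat.card_eq_fintype_card]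
    rfl
  · rw [collisions3_eq, ncard_pairs (.inl rfl)]
  · rw [collisions4_eq, ncard_range_of_injective (injective_coe_of_disjoint quadBlock_nontrivial
      quadBlock_disjoint), Nat.card_eq_fintype_card]
    rfl
  · rw [pathologicalCollisions5_eq, ncard_range_of_injective
      (f := fun q => (twistBlock q : Set Word)) fun q q' h =>
      Sum.inl_injective (injective_coe_of_disjoint blocks5_nontrivial blocks5_disjoint
        (a₁ := .inl q) (a₂ := .inl q') h), Nat.card_eq_fintype_card]
    rfl
  · rw [regularCollisions5_eq, ncard_pairs (by omega)]
  · rw [collisionsEven_eq, ncard_pairs (by omega)]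
  · rw [collisionsOdd_eq, ncard_pairs (by omega)]
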